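/- **Theorem (copies of $P_3$).** All graphs are finite and simple. Let $P_m$ denote the path with $m$ edges (so $m+1$ vertices), let $\mathcal N(H,G)$ be the number of (not necessarily induced) copies of $H$ in $G$, i.e. the number of subgraphs of $G$ isomorphic to $H$, and let $\mathrm{ex}(n,H,F)$ be the maximum of $\mathcal N(H,G)$ over all $n$-vertex graphs $G$ that contain no (not necessarily induced) copy of $F$. For integers $n,k,a$ with $2a\le k\le n+a$, let $G_{n,k,a}$ be the $n$-vertex graph whose vertex set is partitioned into classes $A,B,C$ with $|A|=a$, $|B|=n-k+a$, $|C|=k-2a$, such that $A\cup C$ induces a clique, $B$ is an independent set, all edges between $A$ and $B$ are present, and there are no edges between $B$ and $C$. Let $k\ge 5$ be an integer and $t=\lfloor (k-1)/2\rfloor$. There exists $n_1\in\mathbb N$ (depending on $k$) such that for all $n\ge n_1$, $$\mathrm{ex}(n,P_3,P_k)=\mathcal N(P_3,G_{n,k,t}),$$ and, up to isomorphism, $G_{n,k,t}$ is the only $n$-vertex graph containing no copy of $P_k$ that has $\mathrm{ex}(n,P_3,P_k)$ copies of $P_3$. Moreover, for fixed $k$, as $n\to\infty$, $$\mathrm{ex}(n,P_3,P_k)=\frac{3t(t-1)}{2}\,n^2+O(n).$$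 -/

import Mathlib

open Filter Asymptotics

namespace GenTuran

/-- The path `P_m` of length `m`, that is, with `m` edges and `m + 1` vertices. -/
abbrev pathOfLength (m : ℕ) : SimpleGraph (Fin (m + 1)) := SimpleGraph.pathGraph (m + 1)

open Classical in
/-- `ex(n, H, F)`: the maximum number of (not necessarily induced, unlabelled) copies of `H`
in an `n`-vertex graph containing no (not necessarily induced) copy of `F`. -/
noncomputable def ex (n : ℕ) {W W' : Type*} (H : SimpleGraph W) (F : SimpleGraph W') : ℕ :=
  (Finset.univ.filter fun G : SimpleGraph (Fin n) => F.Free G).sup fun G => G.copyCount H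

/-- `G` is extremal for `ex(n, H, F)`: it is `F`-free and it has the maximum number of
copies of `H`. -/
def IsExtremalFor {n : ℕ} {W W' : Type*} (G : SimpleGraph (Fin n))
    (H : SimpleGraph W) (F : SimpleGraph W') : Prop :=
  F.Free G ∧ G.copyCount H = ex n H F

/-- The graph `G_{n,k,a}` (for `2 * a ≤ k` and `k ≤ n + a`). The vertex set `{0, …, n - 1}` is
split into `A = {i | i < a}`, `C = {i | a ≤ i < k - a}` and `B = {i | k - a ≤ i}`, of sizes
`a`, `k - 2a` and `n - k + a`. The set `A ∪ C = {i | i < k - a}` is a clique, `B` is independent,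
all edges between `A` and `B` are present, and there are no edges between `B` and `C`. -/
def extGraph (n k a : ℕ) : SimpleGraph (Fin n) where
  Adj i j := i ≠ j ∧ ((i.val < k - a ∧ j.val < k - a) ∨ i.val < a ∨ j.val < a)
  symm := ⟨fun i j h => by
    obtain ⟨h₁, h₂⟩ := h
    exact ⟨h₁.symm, by tauto⟩⟩
  loopless := ⟨fun i h => h.1 rfl⟩

end GenTuran

/-! Here `k` is `2t+1` or `2t+2`, so a `P_k`-free graph has no path on `2t+3` vertices. Copies of
`P_3` are counted as sequences of four vertices, each copy twice (`two_mul_copyCount`), so the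
target is `3t(t-1)n² + O(n)`. It is attained by the hub graph on a `t`-set `A`, whose edges are all
pairs meeting `A`.

Stability. Without long paths the number of edges is linear, so few vertices have large degree.
These are enlarged to a small set `L`, and a small set `Z` with few edges to `W = (L ∪ Z)ᶜ` is
removed, such that a vertex of `W` with `s > 0` neighbours in `L` starts only paths in `W` with at
most `t+1-s` vertices (`exists_sparse_cleaning_set`). Otherwise one could zigzag between `L` and
vertices violating this until the path has `2t+3` vertices. Up to a small error, copies of `P_3` are
then indexed by pairs of vertices of `W`, and their number is bounded by a sum of vertex weights
(`card_fourPaths_add_le`). A component of `G[W]` in which `j > 0` is the largest number of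
neighbours in `L` is `(t-j)`-degenerate, so its average weight is at most `3t(t-1)`, with a loss for
every vertex that has fewer than `t` neighbours in `L` (`sum_weight_le`). A nearly extremal graph
therefore has a `t`-set `A` with almost all vertices as common neighbours (`exists_hub_set`).

Exact structure. `A` can be threaded through its common neighbours into a path on `2t-1` vertices
with prescribed distinct ends in `A`, to which paths outside `A` can be attached. This restricts the
edges outside `A` severely (`outerEdges_of_noPath`). Unless they form at most a single edge (none,
if `k` is odd), the outer vertices they touch lie on average on fewer copies, to order `n`, than in
the hub graph (`OuterEdges.sum_charge_le`), so the hub graph has strictly more copies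
(`card_fourPaths_lt_hubGraph`). In the remaining case the graph embeds into `extGraph n k t`. Every
edge of the latter lies on a `P_3`, so a proper subgraph has fewer copies, and equality forces an
isomorphism (`nonempty_iso_extGraph`). -/

namespace GenTuran

/-! ### Paths as vertex lists, greedy extension, degeneracy -/

section Paths

variable {V : Type*} {G : SimpleGraph V}

/-- The list of vertices of a path in `G`. -/
def IsPathList (G : SimpleGraph V) (l : List V) : Prop := l.IsChain G.Adj ∧ l.Nodup

/-- Every path of `G` has fewer than `m` vertices. -/
def NoPath (G : SimpleGraph V) (m : ℕ) : Prop := ∀ l, IsPathList G l → l.length < m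

theorem IsPathList.cons {a b : V} {l : List V} (h : IsPathList G (b :: l)) (hab : G.Adj a b)
    (ha : a ∉ b :: l) : IsPathList G (a :: b :: l) :=
  ⟨List.isChain_cons_cons.2 ⟨hab, h.1⟩, List.nodup_cons.2 ⟨ha, h.2⟩⟩

theorem IsPathList.suffix {l l' : List V} (h : IsPathList G l) (hl : l' <:+ l) :
    IsPathList G l' := ⟨h.1.suffix hl, h.2.sublist hl.sublist⟩

theorem IsPathList.take {l : List V} (h : IsPathList G l) (m : ℕ) : IsPathList G (l.take m) :=
  ⟨h.1.take m, h.2.sublist (List.take_sublist m l)⟩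

theorem IsPathList.reverse {l : List V} (h : IsPathList G l) : IsPathList G l.reverse := by
  refine ⟨?_, List.nodup_reverse.2 h.2⟩
  rw [List.isChain_reverse]
  exact h.1.imp fun _ _ hab => hab.symm

/-- Two paths starting at adjacent vertices join to a path. -/
theorem IsPathList.join {a b : V} {l l' : List V} (h : IsPathList G (a :: l))
    (h' : IsPathList G (b :: l')) (hab : G.Adj a b)
    (hd : ∀ v ∈ a :: l, v ∉ b :: l') : IsPathList G ((a :: l).reverse ++ b :: l') := by
  refine ⟨?_, ?_⟩
  · rw [List.isChain_append]
    refine ⟨h.reverse.1, h'.1, ?_⟩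
    intro x hx y hy
    simp at hx hy
    subst hx hy
    exact hab
  · rw [List.nodup_append']
    refine ⟨h.reverse.2, h'.2, ?_⟩
    intro v hv
    exact hd v (List.mem_reverse.1 hv)

theorem free_pathOfLength_iff {k : ℕ} : (pathOfLength k).Free G ↔ NoPath G (k + 1) := by
  constructor
  · intro h l hl
    by_contra! hlen
    apply h
    have hl' := hl.take (k + 1)
    have hlen' : (l.take (k + 1)).length = k + 1 := by simp [hlen]
    generalize l.take (k + 1) = l' at hl' hlen'
    refine ⟨⟨⟨fun i => l'.get (i.cast hlen'.symm), ?_⟩, ?_⟩⟩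
    · intro i j hij
      rw [SimpleGraph.pathGraph_adj] at hij
      have hc := List.isChain_iff_getElem.1 hl'.1
      rcases hij with hij | hij
      · have := hc i (by omega)
        simpa [hij] using this
      · have := hc j (by omega)
        simpa [hij] using this.symm
    · intro i j hij
      have := (List.Nodup.get_inj_iff hl'.2).1 hij
      simpa [Fin.ext_iff] using this
  · rintro h ⟨f⟩
    have := h (List.ofFn f) ⟨?_, List.nodup_ofFn.2 f.injective⟩
    · simp at this
    · rw [List.isChain_iff_getElem]
      intro i hi
      simp only [List.getElem_ofFn]
      apply f.toHom.map_adj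
      rw [SimpleGraph.pathGraph_adj]
      simp

/-- Cutting a path so that only its head lies in `U` prepares it for `exists_greedy_extension`. -/
theorem exists_suffix_first_mem {U : Finset V} {l : List V} (h : ∃ v ∈ l, v ∈ U) :
    ∃ u r, (u :: r) <:+ l ∧ u ∈ U ∧ ∀ v ∈ r, v ∉ U := by
  induction l with
  | nil => simp at h
  | cons a l ih =>
    by_cases hl : ∃ v ∈ l, v ∈ U
    · obtain ⟨u, r, h1, h2, h3⟩ := ih hl
      exact ⟨u, r, h1.trans (List.suffix_cons a l), h2, h3⟩
    · push Not at hl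
      obtain ⟨v, hv, hvU⟩ := h
      refine ⟨a, l, List.suffix_rfl, ?_, hl⟩
      rcases List.mem_cons.1 hv with rfl | hv
      · exact hvU
      · exact absurd hvU (hl v hv)

/-- The number of neighbours of `x` in `U`. -/
def dg (G : SimpleGraph V) [DecidableRel G.Adj] (U : Finset V) (x : V) : ℕ :=
  (U.filter (G.Adj x)).card

variable [DecidableEq V] [DecidableRel G.Adj]

/-- A path ending in a set of large minimum degree extends greedily. -/
theorem exists_greedy_extension {U : Finset V} {q : ℕ} (hU : ∀ u ∈ U, q ≤ dg G U u) {u : V}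
    {r : List V} (hl : IsPathList G (u :: r)) (hu : u ∈ U) (hr : ∀ v ∈ r, v ∉ U) {i : ℕ}
    (hi : i ≤ q) :
    ∃ v s, IsPathList G (v :: s) ∧ v ∈ U ∧ (v :: s).length = (u :: r).length + i ∧
      ((s.toFinset) ∩ U).card = i ∧ (u :: r) <:+ (v :: s) ∧
      ∀ x ∈ v :: s, x ∈ U ∨ x ∈ u :: r := by
  induction i with
  | zero =>
    refine ⟨u, r, hl, hu, rfl, ?_, List.suffix_rfl, fun x hx => Or.inr hx⟩
    rw [Finset.card_eq_zero]
    ext x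
    simp only [Finset.mem_inter, List.mem_toFinset, Finset.notMem_empty, iff_false, not_and]
    exact hr x
  | succ i ih =>
    obtain ⟨v, s, h1, h2, h3, h4, h5, h6⟩ := ih (by omega)
    -- The head `v` is not its own neighbour, so only the `i` vertices of `U` in the tail are
    -- forbidden. This is what permits `q` extension steps, hence `q + 1` vertices in `U`.
    have hlt : (s.toFinset ∩ U).card < (U.filter (G.Adj v)).card := by
      have := hU v h2
      unfold dg at this
      omega
    obtain ⟨w, hw, hw'⟩ := Finset.exists_mem_notMem_of_card_lt_card hlt
    rw [Finset.mem_filter] at hw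
    have hws : w ∉ v :: s := by
      intro hmem
      rcases List.mem_cons.1 hmem with rfl | hmem
      · exact G.loopless.irrefl _ hw.2
      · exact hw' (by simp [hmem, hw.1])
    refine ⟨w, v :: s, h1.cons hw.2.symm hws, hw.1, by simp at h3 ⊢; omega, ?_,
      h5.trans (List.suffix_cons _ _), ?_⟩
    · rw [List.toFinset_cons, Finset.insert_inter_of_mem h2, Finset.card_insert_of_notMem, h4]
      have := h1.2
      simp at this
      simp [this.1]
    · intro x hx
      rcases List.mem_cons.1 hx with rfl | hx
      · exact Or.inl hw.1
      · exact h6 x hx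

theorem exists_dg_lt_of_noPath {K : ℕ} (h : NoPath G (K + 1)) {U : Finset V} (hU : U.Nonempty) :
    ∃ x ∈ U, dg G U x < K := by
  by_contra! hc
  obtain ⟨u, hu⟩ := hU
  obtain ⟨v, s, h1, -, h3, -⟩ := exists_greedy_extension hc (u := u) (r := [])
    ⟨by simp, by simp⟩ hu (by simp) le_rfl
  have := h _ h1
  simp at h3 this
  omega

/-- The sum of degrees in a `q`-degenerate induced subgraph. -/
theorem sum_dg_le_of_degenerate {q : ℕ} (U : Finset V)
    (h : ∀ U' ⊆ U, U'.Nonempty → ∃ x ∈ U', dg G U' x ≤ q) :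
    ∑ x ∈ U, dg G U x ≤ 2 * q * U.card := by
  induction hn : U.card generalizing U with
  | zero => simp [Finset.card_eq_zero.1 hn]
  | succ n ih =>
    obtain ⟨x, hx, hq⟩ := h U le_rfl (Finset.card_pos.1 (by omega))
    have h1 := ih (U.erase x)
      (fun U' hU' => h U' (hU'.trans (Finset.erase_subset _ _))) (by simp [hx, hn])
    have h2 : ∀ y ∈ U.erase x, dg G U y = dg G (U.erase x) y + if G.Adj y x then 1 else 0 := by
      intro y hy
      unfold dg
      nth_rewrite 1 [← Finset.insert_erase hx]
      rw [Finset.filter_insert]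
      split_ifs with hyx
      · rw [Finset.card_insert_of_notMem (by simp)]
      · rfl
    have h3 : dg G U x = ∑ y ∈ U.erase x, if G.Adj y x then 1 else 0 := by
      unfold dg
      rw [Finset.card_filter, ← Finset.add_sum_erase _ _ hx]
      simp [G.adj_comm]
    rw [← Finset.add_sum_erase _ _ hx, Finset.sum_congr rfl h2, Finset.sum_add_distrib, ← h3]
    nlinarith

theorem sum_dg_le_of_noPath {K : ℕ} (h : NoPath G (K + 1)) (U : Finset V) :
    ∑ x ∈ U, dg G U x ≤ 2 * K * U.card :=
  sum_dg_le_of_degenerate U fun U' _ hne => by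
    obtain ⟨x, hx, hlt⟩ := exists_dg_lt_of_noPath h hne
    exact ⟨x, hx, hlt.le⟩

end Paths

/-! ### Removing overfull vertices -/

section Cleaning

variable {V : Type*} [DecidableEq V] {G : SimpleGraph V} [DecidableRel G.Adj]

/-- The vertices of the path `l` avoid `S`. -/
def Avoids (l : List V) (S : Finset V) : Prop := ∀ v ∈ l, v ∉ S

/-- `x` has neighbours in `L`, and so many that, together with the number of vertices of some path
starting from `x` and avoiding `L ∪ Z`, they exceed `t + 1`. -/
def Overfull (G : SimpleGraph V) [DecidableRel G.Adj] (t : ℕ) (L Z : Finset V) (x : V) : Prop :=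
  0 < dg G L x ∧ ∃ l, IsPathList G (x :: l) ∧ Avoids (x :: l) (L ∪ Z) ∧
    t + 2 ≤ (x :: l).length + dg G L x

theorem Overfull.mono {t : ℕ} {L Z Z' : Finset V} {x : V} (h : Overfull G t L Z' x)
    (hZ : Z ⊆ Z') : Overfull G t L Z x := by
  obtain ⟨h0, l, h1, h2, h3⟩ := h
  exact ⟨h0, l, h1, fun v hv hv' => h2 v hv (Finset.union_subset_union_right hZ hv'), h3⟩

/-- If every vertex of `L` that is adjacent to an overfull vertex remains so after the deletion of
any `2 * t + 3` vertices, then there is a path with `2 * t + 3` vertices. -/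
theorem exists_long_path_of_overfull {t : ℕ} {L Z : Finset V} {s : ℕ}
    (hs : ∀ x, Overfull G t L Z x → s ≤ dg G L x)
    (hL : ∀ x, Overfull G t L Z x → ∀ a ∈ L, G.Adj x a → ∀ S : Finset V, S.card ≤ 2 * t + 3 →
      ∃ y, G.Adj a y ∧ Overfull G t L (Z ∪ (S \ L)) y) (fuel : ℕ) :
    ∀ (a : V) (Q : List V) (j : ℕ), a ∈ L → (∃ x, Overfull G t L Z x ∧ G.Adj x a) →
      IsPathList G (a :: Q) → ((a :: Q).toFinset ∩ L).card = j → 0 < j →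
      t + 1 + 2 * j ≤ (a :: Q).length + s → 2 * t + 3 ≤ (a :: Q).length + fuel →
      ∃ l, IsPathList G l ∧ 2 * t + 3 ≤ l.length := by
  induction fuel with
  | zero => 
    intro a Q j _ _ hP _ _ _ h
    exact ⟨_, hP, h⟩
  | succ fuel ih =>
    intro a Q j ha ⟨x, hx, hxa⟩ hP hj hj0 hlen hfuel
    by_cases hlong : 2 * t + 3 ≤ (a :: Q).length
    · exact ⟨_, hP, hlong⟩
    obtain ⟨y, hay, hy⟩ := hL x hx a ha hxa (a :: Q).toFinset
      ((List.toFinset_card_le _).trans (by omega))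
    have hy' : Overfull G t L Z y := hy.mono Finset.subset_union_left
    obtain ⟨-, l, hl1, hl2, hl3⟩ := hy
    have hdisj : ∀ v ∈ y :: l, v ∉ a :: Q := by
      intro v hv hvQ
      have := hl2 v hv
      simp only [Finset.mem_union, Finset.mem_sdiff, List.mem_toFinset] at this
      tauto
    by_cases hall : L.filter (G.Adj y) ⊆ (a :: Q).toFinset
    -- All neighbours of `y` in `L` are on the path already, so `s ≤ dg G L y ≤ j`. The two pieces
    -- have at least `t + 2 - dg G L y` and `t + 1 + 2 * j - s` vertices, together at least `2 * t +
    -- 3`.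
    · refine ⟨_, hl1.join hP hay.symm hdisj, ?_⟩
      have h1 : dg G L y ≤ j := by
        rw [← hj]
        exact Finset.card_le_card (Finset.subset_inter hall (Finset.filter_subset _ _))
      have h2 := hs y hy'
      simp only [List.length_append, List.length_reverse]
      omega
    · obtain ⟨b, hb, hbQ⟩ := Finset.not_subset.1 hall
      rw [Finset.mem_filter] at hb
      have hyL : y ∉ L := fun h => hl2 y (by simp) (by simp [h])
      have hby : b ∉ y :: a :: Q := by
        rw [List.mem_toFinset] at hbQ
        rw [List.mem_cons]
        rintro (rfl | h)
        · exact hyL hb.1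
        · exact hbQ h
      refine ih b (y :: a :: Q) (j + 1) hb.1 ⟨y, hy', hb.2⟩
        ((hP.cons hay.symm (hdisj y (by simp))).cons hb.2.symm hby) ?_ (by omega) ?_ ?_
      · rw [List.toFinset_cons, Finset.insert_inter_of_mem hb.1, Finset.card_insert_of_notMem,
          List.toFinset_cons, Finset.insert_inter_of_notMem hyL, hj]
        rw [Finset.mem_inter, List.mem_toFinset]
        exact fun h => hby h.1
      · simp only [List.length_cons] at hlen ⊢
        omega
      · simp only [List.length_cons] at hfuel ⊢
        omega

/-- In a graph without paths on `2 * t + 3` vertices, few vertices outside `L` can be deleted such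
that no remaining vertex is overfull. -/
theorem exists_cleaning_set {t : ℕ} (h : NoPath G (2 * t + 3)) (L : Finset V) :
    ∃ Z : Finset V, Disjoint Z L ∧ Z.card ≤ (2 * t + 3) * L.card ∧ ∀ x, ¬ Overfull G t L Z x := by
  classical
  -- `P M` says that the vertices of `M` can be cut off from all overfull vertices at a cost of `2 *
  -- t + 3` deletions each. If overfull vertices survive for a maximal `M ⊆ L`, their neighbours in
  -- `L` cannot be cut off at this cost, which is the robustness needed for a long path.
  let P : Finset V → Prop := fun M => ∃ Z : Finset V, Disjoint Z L ∧
    Z.card ≤ (2 * t + 3) * M.card ∧ ∀ a ∈ M, ∀ x, G.Adj a x → ¬ Overfull G t L Z x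
  obtain ⟨M, hM, hmax⟩ := Finset.exists_max_image (L.powerset.filter P) Finset.card
    ⟨∅, by simp only [Finset.mem_filter, Finset.empty_mem_powerset, true_and]
           exact ⟨∅, by simp, by simp, by simp⟩⟩
  rw [Finset.mem_filter, Finset.mem_powerset] at hM
  obtain ⟨hML, Z, hZ1, hZ2, hZ3⟩ := hM
  by_cases hno : ∀ x, ¬ Overfull G t L Z x
  · exact ⟨Z, hZ1, hZ2.trans (Nat.mul_le_mul le_rfl (Finset.card_le_card hML)), hno⟩
  exfalso
  push Not at hno
  have hex : ∃ s, ∃ x, Overfull G t L Z x ∧ dg G L x = s := by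
    obtain ⟨x, hx⟩ := hno
    exact ⟨_, x, hx, rfl⟩
  classical
  -- An overfull vertex with the fewest neighbours in `L`. With `s = dg G L x`, the path consisting
  -- of a neighbour in `L` followed by the witness of overfullness satisfies the length invariant
  -- for `j = 1`.
  obtain ⟨x, hx, hxs⟩ := Nat.find_spec hex
  have hmin : ∀ y, Overfull G t L Z y → dg G L x ≤ dg G L y := by
    intro y hy
    rw [hxs]
    exact Nat.find_min' hex ⟨y, hy, rfl⟩
  have hL : ∀ x, Overfull G t L Z x → ∀ a ∈ L, G.Adj x a → ∀ S : Finset V,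
      S.card ≤ 2 * t + 3 → ∃ y, G.Adj a y ∧ Overfull G t L (Z ∪ (S \ L)) y := by
    intro x hx a ha hxa S hS
    by_contra! hcon
    have haM : a ∉ M := fun haM => hZ3 a haM x hxa.symm hx
    have hins : insert a M ∈ L.powerset.filter P := by
      rw [Finset.mem_filter, Finset.mem_powerset]
      refine ⟨Finset.insert_subset ha hML, Z ∪ (S \ L), ?_, ?_, ?_⟩
      · rw [Finset.disjoint_union_left]
        exact ⟨hZ1, Finset.sdiff_disjoint⟩
      · rw [Finset.card_insert_of_notMem haM]
        have := Finset.card_le_card (Finset.sdiff_subset (s := S) (t := L))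
        have := Finset.card_union_le Z (S \ L)
        rw [Nat.mul_add]
        omega
      · intro b hb y hby hy
        rcases Finset.mem_insert.1 hb with rfl | hb
        · exact hcon y hby hy
        · exact hZ3 b hb y hby (hy.mono Finset.subset_union_left)
    have := hmax _ hins
    rw [Finset.card_insert_of_notMem haM] at this
    omega
  obtain ⟨h0, l, hl1, hl2, hl3⟩ := id hx
  obtain ⟨a, ha⟩ := Finset.card_pos.1 h0
  rw [Finset.mem_filter] at ha
  have hal : a ∉ x :: l := fun hmem => hl2 a hmem (by simp [ha.1])
  obtain ⟨l', hl', hlen⟩ := exists_long_path_of_overfull hmin hL (2 * t + 3) a (x :: l) 1 ha.1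
    ⟨x, hx, ha.2⟩ (hl1.cons ha.2.symm hal) (by
      rw [List.toFinset_cons, Finset.insert_inter_of_mem ha.1, Finset.card_insert_of_notMem]
      · have : (x :: l).toFinset ∩ L = ∅ := by
          ext v
          simp only [Finset.mem_inter, List.mem_toFinset, Finset.notMem_empty, iff_false, not_and]
          exact fun hv hvL => hl2 v hv (by simp [hvL])
        rw [this]; rfl
      · rw [Finset.mem_inter, List.mem_toFinset]
        exact fun h => hal h.1)
    (by omega) (by simp only [List.length_cons] at hl3 ⊢; omega) (by omega)
  exact absurd (h l' hl') (by omega)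

end Cleaning

/-! ### Sparse cleaning and vertex weights -/

section Splitting

variable {V : Type*} [DecidableEq V] {G : SimpleGraph V} [DecidableRel G.Adj]

omit [DecidableEq V] in
theorem dg_mono {A B : Finset V} (h : A ⊆ B) (x : V) : dg G A x ≤ dg G B x :=
  Finset.card_le_card (Finset.filter_subset_filter _ h)

omit [DecidableEq V] in
theorem dg_le_card (A : Finset V) (x : V) : dg G A x ≤ A.card :=
  Finset.card_le_card (Finset.filter_subset _ _)

/-- If the cleaning set `Z` sends more than `m` edges to the rest, absorb it into `L` and clean
again. Each repetition lowers the degree sum inside `Lᶜ` by more than `m`, so `r` repetitions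
suffice, and each multiplies the size by at most `2 * t + 4`. -/
theorem exists_sparse_cleaning_set [Fintype V] {t : ℕ} (h : NoPath G (2 * t + 3)) (m r : ℕ) :
    ∀ L : Finset V, ∑ x ∈ Lᶜ, dg G Lᶜ x ≤ r * m →
    ∃ L' Z : Finset V, L ⊆ L' ∧ Disjoint Z L' ∧ (L' ∪ Z).card ≤ (2 * t + 4) ^ (r + 1) * L.card ∧
      ∑ x ∈ Z, dg G (L' ∪ Z)ᶜ x ≤ m ∧ ∀ x, ¬ Overfull G t L' Z x := by
  have key : ∀ L Z : Finset V, Disjoint Z L →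
      ∑ x ∈ (L ∪ Z)ᶜ, dg G (L ∪ Z)ᶜ x + ∑ x ∈ Z, dg G (L ∪ Z)ᶜ x ≤ ∑ x ∈ Lᶜ, dg G Lᶜ x := by
    intro L Z hZ
    have hdisj : Disjoint (L ∪ Z)ᶜ Z :=
      (disjoint_compl_left).mono_right (Finset.subset_union_right)
    have hsub : (L ∪ Z)ᶜ ⊆ Lᶜ := Finset.compl_subset_compl.2 Finset.subset_union_left
    rw [← Finset.sum_union hdisj]
    have hU : (L ∪ Z)ᶜ ∪ Z ⊆ Lᶜ := Finset.union_subset hsub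
      (by rw [Finset.subset_compl_comm]; exact Finset.subset_compl_iff_disjoint_right.2 hZ.symm)
    calc _ ≤ ∑ x ∈ (L ∪ Z)ᶜ ∪ Z, dg G Lᶜ x := Finset.sum_le_sum fun x _ => dg_mono hsub x
      _ ≤ _ := Finset.sum_le_sum_of_subset hU
  induction r with
  | zero =>
    intro L hL
    obtain ⟨Z, hZ1, hZ2, hZ3⟩ := exists_cleaning_set h L
    refine ⟨L, Z, le_rfl, hZ1, ?_, ?_, hZ3⟩
    · have := Finset.card_union_le L Z
      simp only [zero_add, pow_one]
      nlinarith
    · have := key L Z hZ1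
      omega
  | succ r ih =>
    intro L hL
    obtain ⟨Z, hZ1, hZ2, hZ3⟩ := exists_cleaning_set h L
    have hcard : (L ∪ Z).card ≤ (2 * t + 4) * L.card := by
      have := Finset.card_union_le L Z
      nlinarith
    by_cases hm : ∑ x ∈ Z, dg G (L ∪ Z)ᶜ x ≤ m
    · refine ⟨L, Z, le_rfl, hZ1, hcard.trans ?_, hm, hZ3⟩
      exact Nat.mul_le_mul (Nat.le_self_pow (by omega) _) le_rfl
    · obtain ⟨L', Z', h1, h2, h3, h4, h5⟩ := ih (L ∪ Z) (by
        have := key L Z hZ1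
        rw [Nat.succ_mul] at hL
        omega)
      refine ⟨L', Z', Finset.subset_union_left.trans h1, h2, h3.trans ?_, h4, h5⟩
      calc _ ≤ (2 * t + 4) ^ (r + 1) * ((2 * t + 4) * L.card) := Nat.mul_le_mul le_rfl hcard
        _ = _ := by ring

/-- The edges of `G` inside `W`. -/
def within (G : SimpleGraph V) (W : Finset V) : SimpleGraph V where
  Adj a b := G.Adj a b ∧ a ∈ W ∧ b ∈ W
  symm := ⟨fun _ _ h => ⟨h.1.symm, h.2.2, h.2.1⟩⟩
  loopless := ⟨fun _ h => G.loopless.irrefl _ h.1⟩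

omit [DecidableEq V] [DecidableRel G.Adj] in
-- Induction along a walk, cutting back to a suffix when a vertex repeats. The suffix `[z]` records
-- that the path ends in `z`.
theorem exists_pathList_of_reachable {W : Finset V} {x z : V} (h : (within G W).Reachable x z)
    (hz : z ∈ W) : ∃ r, IsPathList G (x :: r) ∧ [z] <:+ (x :: r) ∧ ∀ v ∈ x :: r, v ∈ W := by
  obtain ⟨p⟩ := h
  induction p with
  | nil => exact ⟨[], ⟨by simp, by simp⟩, List.suffix_rfl, by simpa using hz⟩
  | @cons x y z hxy p ih =>
    obtain ⟨r, h1, h2, h3⟩ := ih hz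
    by_cases hx : x ∈ y :: r
    · obtain ⟨p, q, hpq⟩ := List.append_of_mem hx
      have hs : (x :: q) <:+ (y :: r) := ⟨p, hpq.symm⟩
      exact ⟨q, h1.suffix hs, List.suffix_of_suffix_length_le h2 hs (by simp),
        fun v hv => h3 v (hs.subset hv)⟩
    · refine ⟨y :: r, h1.cons hxy.1 hx, h2.trans (List.suffix_cons _ _), ?_⟩
      intro v hv
      rcases List.mem_cons.1 hv with rfl | hv
      · exact hxy.2.1
      · exact h3 v hv

/-- If `U` had minimum degree above `t - j`, a path from `z` to `U` could be continued greedily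
inside `U` to at least `t - j + 2` vertices. Read from `z`, it would make `z` overfull. -/
theorem exists_dg_le_of_not_overfull [Fintype V] {t j : ℕ} {L Z U : Finset V}
    (h : ∀ x, ¬ Overfull G t L Z x) (hj : 0 < j) (hU : U ⊆ (L ∪ Z)ᶜ) {u z : V} (hu : u ∈ U)
    (hz : z ∈ (L ∪ Z)ᶜ) (hzj : dg G L z = j)
    (hreach : (within G (L ∪ Z)ᶜ).Reachable u z) : ∃ x ∈ U, dg G U x ≤ t - j := by
  by_contra! hcon
  obtain ⟨r, h1, h2, h3⟩ := exists_pathList_of_reachable hreach hz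
  obtain ⟨v, s, hs1, hs2, hs3⟩ := exists_suffix_first_mem (U := U) (l := u :: r)
    ⟨u, by simp, hu⟩
  have hzs : [z] <:+ v :: s := List.suffix_of_suffix_length_le h2 hs1 (by simp)
  obtain ⟨w, q, h4, h5, h6, -, h8, h9⟩ := exists_greedy_extension (q := t - j + 1)
    (fun u hu => hcon u hu) (h1.suffix hs1) hs2 hs3 le_rfl
  obtain ⟨p, hp⟩ := hzs.trans h8
  have h4' := h4.reverse
  rw [← hp, List.reverse_append, List.reverse_singleton, List.singleton_append] at h4'
  refine h z ⟨by omega, p.reverse, h4', ?_, ?_⟩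
  · intro x hx
    have hx' : x ∈ w :: q := by
      rw [← hp]
      simp at hx ⊢
      tauto
    rw [← Finset.mem_compl]
    rcases h9 x hx' with hx | hx
    · exact hU hx
    · exact h3 x (hs1.subset hx)
  · have : (z :: p.reverse).length = (w :: q).length := by
      rw [← hp]; simp
    rw [this, h6, hzj, List.length_cons]
    omega

/-- The weight of a vertex with `s` neighbours in `L`. -/
def pairWeight (s : ℕ) : ℕ := 3 * s * (s - 1) + if s = 1 then 1 else 0

theorem pairWeight_mono {s j : ℕ} (h : s ≤ j) : pairWeight s ≤ pairWeight j := by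
  unfold pairWeight
  rcases Nat.lt_or_ge s 2 with hs | hs
  · rcases Nat.lt_or_ge j 2 with hj | hj
    · interval_cases s <;> interval_cases j <;> simp_all
    · obtain ⟨j, rfl⟩ := Nat.exists_eq_add_of_le hj
      interval_cases s
      · simp
      · simp only [show 2 + j - 1 = j + 1 by omega, show (2 + j = 1) = False by simp; omega]
        simp
        nlinarith
  · rw [if_neg (by omega), if_neg (by omega)]
    exact Nat.mul_le_mul (by omega) (by omega)

/-- In a component whose vertices have at most `j < t` neighbours in `L`, the edges permitted inside
`W`, average degree at most `2 * (t - j)`, do not compensate for the missing neighbours; at least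
one unit per vertex is lost. -/
theorem pairWeight_add_lt {t j : ℕ} (ht : 2 ≤ t) (h : j < t) :
    pairWeight j + 4 * j * (t - j) + 1 ≤ 3 * t * (t - 1) := by
  unfold pairWeight
  obtain ⟨d, rfl⟩ := Nat.exists_eq_add_of_lt h
  rcases Nat.lt_or_ge j 2 with hj | hj
  · interval_cases j
    · simp; nlinarith
    · simp only [show 1 + d + 1 - 1 = d + 1 by omega]
      simp; nlinarith
  · obtain ⟨i, rfl⟩ := Nat.exists_eq_add_of_le hj
    rw [if_neg (by omega), show 2 + i + d + 1 - (2 + i) = d + 1 by omega,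
      show 2 + i - 1 = i + 1 by omega, show 2 + i + d + 1 - 1 = i + d + 2 by omega]
    nlinarith [Nat.zero_le (i * d), Nat.zero_le (d * d)]

/-- The bound holds separately on the unions of components of `G[W]` with the same maximum `j` of
`dg G L`. For `j < t` degeneracy gives a strict loss at every vertex. For `j = t` there are no edges
left, and each vertex with fewer than `t` neighbours in `L` loses on its own. -/
theorem sum_weight_le [Fintype V] {t : ℕ} (ht : 2 ≤ t) {L Z : Finset V}
    (h : ∀ x, ¬ Overfull G t L Z x) :
    ∑ x ∈ (L ∪ Z)ᶜ, (pairWeight (dg G L x) + 2 * dg G L x * dg G (L ∪ Z)ᶜ x) +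
      ((L ∪ Z)ᶜ.filter fun x => dg G L x < t).card ≤ 3 * t * (t - 1) * (L ∪ Z)ᶜ.card := by
  classical
  set W := (L ∪ Z)ᶜ with hW
  have hWt : ∀ x ∈ W, dg G L x ≤ t := by
    intro x hx
    by_contra! hlt
    refine h x ⟨by omega, [], ⟨by simp, by simp⟩, ?_, by simp; omega⟩
    intro v hv
    rw [List.mem_singleton.1 hv, ← Finset.mem_compl]
    exact hx
  -- The largest number of neighbours in `L` over the component of `x` in `G[W]`.
  let σ : V → ℕ := fun x => (W.filter fun z => (within G W).Reachable x z).sup (dg G L)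
  have hσt : ∀ x ∈ W, σ x ∈ Finset.range (t + 1) := by
    intro x _
    rw [Finset.mem_range, Nat.lt_succ_iff]
    exact Finset.sup_le fun z hz => hWt z (Finset.mem_filter.1 hz).1
  have hsσ : ∀ x ∈ W, dg G L x ≤ σ x := fun x hx =>
    Finset.le_sup (f := dg G L) (Finset.mem_filter.2 ⟨hx, SimpleGraph.Reachable.refl x⟩)
  have hσadj : ∀ x ∈ W, ∀ y ∈ W, G.Adj x y → σ x = σ y := by
    intro x hx y hy hxy
    have hr : (within G W).Reachable x y := SimpleGraph.Adj.reachable ⟨hxy, hx, hy⟩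
    have : ∀ z, (within G W).Reachable x z ↔ (within G W).Reachable y z :=
      fun z => ⟨fun h => hr.symm.trans h, fun h => hr.trans h⟩
    simp only [σ, this]
  have hσex : ∀ x ∈ W, ∃ z ∈ W, (within G W).Reachable x z ∧ dg G L z = σ x := by
    intro x hx
    obtain ⟨z, hz, hzσ⟩ := Finset.exists_mem_eq_sup
      (W.filter fun z => (within G W).Reachable x z)
      ⟨x, Finset.mem_filter.2 ⟨hx, SimpleGraph.Reachable.refl x⟩⟩ (dg G L)
    rw [Finset.mem_filter] at hz
    exact ⟨z, hz.1, hz.2, hzσ.symm⟩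
  rw [Finset.card_filter, ← Finset.sum_add_distrib, ← Finset.sum_fiberwise_of_maps_to hσt,
    Finset.card_eq_sum_card_fiberwise hσt, Finset.mul_sum]
  refine Finset.sum_le_sum fun j hj => ?_
  set U := W.filter fun x => σ x = j with hUdef
  have hUW : U ⊆ W := Finset.filter_subset _ _
  have hdU : ∀ x ∈ U, dg G W x = dg G U x := by
    intro x hx
    unfold dg
    congr 1
    ext y
    simp only [hUdef, Finset.mem_filter] at hx ⊢
    refine ⟨fun hy => ⟨⟨hy.1, ?_⟩, hy.2⟩, fun hy => ⟨hy.1.1, hy.2⟩⟩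
    rw [← hx.2]
    exact (hσadj x hx.1 y hy.1 hy.2).symm
  have hsj : ∀ x ∈ U, dg G L x ≤ j := by
    intro x hx
    have hx' := Finset.mem_filter.1 hx
    exact hx'.2 ▸ hsσ x hx'.1
  have hsum : 4 * j * (t - j) * U.card ≥ ∑ x ∈ U, 2 * j * dg G U x := by
    rcases Nat.eq_zero_or_pos j with rfl | hj0
    · simp
    · rw [← Finset.mul_sum]
      have := sum_dg_le_of_degenerate (G := G) (q := t - j) U (by
        rintro U' hU' ⟨u, hu⟩
        have huU := Finset.mem_filter.1 (hU' hu)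
        obtain ⟨z, hz1, hz2, hz3⟩ := hσex u huU.1
        exact exists_dg_le_of_not_overfull h hj0 (hU'.trans hUW) hu hz1
          (hz3.trans huU.2) hz2)
      nlinarith
  rw [Finset.mem_range, Nat.lt_succ_iff] at hj
  rcases hj.lt_or_eq with hlt | rfl
  · calc _ ≤ ∑ x ∈ U, ((pairWeight j + 1) + 2 * j * dg G U x) := by
          refine Finset.sum_le_sum fun x hx => ?_
          rw [hdU x hx]
          have h1 := pairWeight_mono (hsj x hx)
          have h2 : 2 * dg G L x * dg G U x ≤ 2 * j * dg G U x :=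
            Nat.mul_le_mul (Nat.mul_le_mul le_rfl (hsj x hx)) le_rfl
          split_ifs <;> omega
      _ ≤ (pairWeight j + 1) * U.card + 4 * j * (t - j) * U.card := by
          rw [Finset.sum_add_distrib, Finset.sum_const, smul_eq_mul, mul_comm]
          omega
      _ = (pairWeight j + 4 * j * (t - j) + 1) * U.card := by ring
      _ ≤ _ := Nat.mul_le_mul (pairWeight_add_lt ht hlt) le_rfl
  · rw [Nat.sub_self, mul_zero, zero_mul] at hsum
    have hj1 : pairWeight j = 3 * j * (j - 1) := by
      unfold pairWeight
      rw [if_neg (by omega), add_zero]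
    calc _ ≤ ∑ x ∈ U, (3 * j * (j - 1) + 2 * j * dg G U x) := by
          refine Finset.sum_le_sum fun x hx => ?_
          rw [hdU x hx]
          have h2 : 2 * dg G L x * dg G U x ≤ 2 * j * dg G U x :=
            Nat.mul_le_mul (Nat.mul_le_mul le_rfl (hsj x hx)) le_rfl
          split_ifs with hlt
          · have := pairWeight_add_lt ht hlt
            have : pairWeight (dg G L x) + 1 ≤ 3 * j * (j - 1) := by omega
            omega
          · have := pairWeight_mono (hsj x hx)
            omega
      _ = 3 * j * (j - 1) * U.card + ∑ x ∈ U, 2 * j * dg G U x := by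
          rw [Finset.sum_add_distrib, Finset.sum_const, smul_eq_mul, mul_comm]
      _ ≤ _ := by omega

end Splitting

/-! ### Counting four-vertex paths by pairs of vertices of W -/

section Counting

variable {V : Type*} [DecidableEq V] [Fintype V] (G : SimpleGraph V) [DecidableRel G.Adj]

/-- The paths with four vertices, as sequences of vertices. -/
def fourPaths : Finset (V × V × V × V) :=
  Finset.univ.filter fun p => G.Adj p.1 p.2.1 ∧ G.Adj p.2.1 p.2.2.1 ∧ G.Adj p.2.2.1 p.2.2.2 ∧
    p.1 ≠ p.2.2.1 ∧ p.1 ≠ p.2.2.2 ∧ p.2.1 ≠ p.2.2.2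

variable {G}

theorem mem_fourPaths {x u v y : V} : (x, u, v, y) ∈ fourPaths G ↔
    G.Adj x u ∧ G.Adj u v ∧ G.Adj v y ∧ x ≠ v ∧ x ≠ y ∧ u ≠ y := by
  simp [fourPaths]

/-- The ordered pairs of adjacent vertices. -/
def darts (G : SimpleGraph V) [DecidableRel G.Adj] : Finset (V × V) :=
  Finset.univ.filter fun p => G.Adj p.1 p.2

omit [DecidableEq V] in
theorem card_darts : (darts G).card = ∑ x, dg G Finset.univ x := by
  unfold darts dg
  simp only [Finset.card_filter]
  rw [← Finset.univ_product_univ, Finset.sum_product]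

omit [DecidableEq V] [Fintype V] in
-- The scheme of the path counts below: `f` reads off the coordinates that serve as index, `g` the
-- others, which range over a set depending on the index.
theorem card_le_sum_card {α β γ : Type*} {S : Finset α} (f : α → β) (g : α → γ) (I : Finset β)
    (B : β → Finset γ) (hinj : ∀ a ∈ S, ∀ b ∈ S, f a = f b → g a = g b → a = b)
    (hS : ∀ a ∈ S, f a ∈ I ∧ g a ∈ B (f a)) : S.card ≤ ∑ b ∈ I, (B b).card := by
  rw [← Finset.card_sigma]
  refine Finset.card_le_card_of_injOn (fun a => ⟨f a, g a⟩) ?_ ?_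
  · intro a ha
    simpa using hS a ha
  · intro a ha b hb hab
    simp only [Sigma.mk.injEq, heq_eq_eq] at hab
    exact hinj a ha b hb hab.1 hab.2

omit [DecidableEq V] [Fintype V] in
theorem quad_ext {p q : V × V × V × V} (h1 : p.1 = q.1) (h2 : p.2.1 = q.2.1)
    (h3 : p.2.2.1 = q.2.2.1) (h4 : p.2.2.2 = q.2.2.2) : p = q :=
  Prod.ext h1 (Prod.ext h2 (Prod.ext h3 h4))

omit [Fintype V] in
theorem card_filter_ne_product (A B : Finset V) :
    ((A ×ˢ B).filter fun p => p.1 ≠ p.2).card + (A ∩ B).card = A.card * B.card := by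
  rw [← Finset.card_product, ← Finset.card_filter_add_card_filter_not (s := A ×ˢ B)
    (fun p => p.1 ≠ p.2)]
  congr 1
  refine Finset.card_bij' (fun a _ => (a, a)) (fun p _ => p.1) ?_ ?_ ?_ ?_
  · intro a ha
    simpa using ha
  · rintro ⟨a, b⟩ h
    simp at h
    obtain ⟨⟨h1, h2⟩, rfl⟩ := h
    simp [h1, h2]
  · simp
  · rintro ⟨a, b⟩ h
    simp at h
    simp [h.2]

/-- Here `s`, `s'` count the neighbours in `L` of two vertices and `i` the common ones. For fixed
`s`, `s'` the worst case is `i = min s s'`, apart from tiny values. The extra 1 in `pairWeight 1` is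
needed only for `s = s' = 1`, `i = 0`. The indicator makes pairs with different `t`-sets pay, which
identifies the hub set later. -/
theorem pairWeight_bound {s s' i t : ℕ} (ht : 2 ≤ t) (hi : i ≤ s) (hi' : i ≤ s') :
    2 * (s * s' + i * s + i * s') + 2 * (if s = t ∧ s' = t ∧ i < t then 1 else 0) ≤
      pairWeight s + pairWeight s' + 6 * i := by
  wlog hss : s ≤ s' generalizing s s'
  · have := this hi' hi (by omega)
    have h2 : (s = t ∧ s' = t ∧ i < t) ↔ (s' = t ∧ s = t ∧ i < t) := by tauto
    simp only [h2]
    nlinarith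
  rcases Nat.eq_zero_or_pos s with rfl | hs
  · rw [if_neg (by omega)]
    have : i = 0 := by omega
    subst this
    simp
  rcases Nat.lt_or_ge (s + s') 3 with h3 | h3
  · have h1 : s = 1 := by omega
    have h2 : s' = 1 := by omega
    subst h1 h2
    rw [if_neg (by omega)]
    simp [pairWeight]
    omega
  have hpw : ∀ j : ℕ, (3 * j * j : ℤ) - 3 * j ≤ pairWeight j := by
    intro j
    unfold pairWeight
    rcases j with _ | j
    · simp
    · rw [Nat.add_sub_cancel]
      split_ifs <;> push_cast <;> nlinarith
  have h1 := hpw s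
  have h2 := hpw s'
  split_ifs with hst
  · obtain ⟨rfl, hst, hlt⟩ := hst
    have hst : s = s' := hst.symm
    subst hst
    zify at *
    have : (i : ℤ) ≤ s - 1 := by omega
    have h4 : (i : ℤ) * (2 * s - 3) ≤ (s - 1) * (2 * s - 3) :=
      mul_le_mul_of_nonneg_right this (by omega)
    push_cast
    nlinarith
  · zify at hi hi' hss hs h3 ⊢
    have h4 : (i : ℤ) * (s + s' - 3) ≤ s * (s + s' - 3) :=
      mul_le_mul_of_nonneg_right hi (by omega)
    push_cast
    have h5 : (0 : ℤ) ≤ (s' - s) * (3 * s' - s - 3) := by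
      rcases hss.lt_or_eq with h | h
      · exact mul_nonneg (by omega) (by omega)
      · rw [h]; simp
    nlinarith

/-- The vertices of `A` adjacent to `x`. -/
def nb (G : SimpleGraph V) [DecidableRel G.Adj] (A : Finset V) (x : V) : Finset V :=
  A.filter (G.Adj x)

omit [DecidableEq V] [Fintype V] in
theorem card_nb (A : Finset V) (x : V) : (nb G A x).card = dg G A x := rfl

omit [DecidableEq V] [Fintype V] in
theorem mem_nb {A : Finset V} {x a : V} : a ∈ nb G A x ↔ a ∈ A ∧ G.Adj x a := Finset.mem_filter

/-- Paths are sorted by the positions of their vertices: WLLW, then WLWL and WLWW with their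
reversals, then a middle edge inside `W` (at most `D ^ 2` paths per dart), then an exceptional first
or last edge. The first five types are indexed by pairs in `W`: the ends for WLLW, the two vertices
of `W` around a vertex of `L` otherwise. -/
theorem card_fourPaths_le {L Z W : Finset V} (hW : W = (L ∪ Z)ᶜ) {D : ℕ}
    (hD : ∀ x ∈ W, dg G Finset.univ x ≤ D) {bad : Finset (V × V)}
    (hbad : ∀ x u, G.Adj x u → (x, u) ∈ bad ∨ (x ∈ W ∧ u ∈ W) ∨ (x ∈ W ∧ u ∈ L) ∨
      (x ∈ L ∧ u ∈ W)) :
    (fourPaths G).card ≤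
      ∑ p ∈ W ×ˢ W, (((nb G L p.1 ×ˢ nb G L p.2).filter fun q => q.1 ≠ q.2).card +
        2 * ((((nb G L p.1 ∩ nb G L p.2) ×ˢ nb G L p.2).filter fun q => q.1 ≠ q.2).card +
          (nb G L p.1 ∩ nb G L p.2).card * dg G W p.2)) +
      D ^ 2 * (darts G).card + 2 * (bad.card * (darts G).card) := by
  classical
  have hLW : ∀ x, x ∈ L → x ∉ W := by
    intro x hx hxW
    rw [hW, Finset.mem_compl] at hxW
    exact hxW (Finset.mem_union_left _ hx)
  let F := fourPaths G
  let C1 := F.filter fun p => p.1 ∈ W ∧ p.2.1 ∈ L ∧ p.2.2.1 ∈ L ∧ p.2.2.2 ∈ W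
  let C2 := F.filter fun p => p.1 ∈ W ∧ p.2.1 ∈ L ∧ p.2.2.1 ∈ W ∧ p.2.2.2 ∈ L
  let C3 := F.filter fun p => p.1 ∈ L ∧ p.2.1 ∈ W ∧ p.2.2.1 ∈ L ∧ p.2.2.2 ∈ W
  let C4 := F.filter fun p => p.1 ∈ W ∧ p.2.1 ∈ L ∧ p.2.2.1 ∈ W ∧ p.2.2.2 ∈ W
  let C5 := F.filter fun p => p.1 ∈ W ∧ p.2.1 ∈ W ∧ p.2.2.1 ∈ L ∧ p.2.2.2 ∈ W
  let C6 := F.filter fun p => p.2.1 ∈ W ∧ p.2.2.1 ∈ W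
  let C7 := F.filter fun p => (p.1, p.2.1) ∈ bad
  let C8 := F.filter fun p => (p.2.2.2, p.2.2.1) ∈ bad
  have hcov : F ⊆ C1 ∪ (C2 ∪ (C3 ∪ (C4 ∪ (C5 ∪ (C6 ∪ (C7 ∪ C8)))))) := by
    rintro ⟨x, u, v, y⟩ hp
    have hp' := mem_fourPaths.1 hp
    have h1 := hbad x u hp'.1
    have h2 := hbad y v hp'.2.2.1.symm
    simp only [C1, C2, C3, C4, C5, C6, C7, C8, Finset.mem_union, Finset.mem_filter, hp, true_and]
    clear hbad hD hW hLW
    rcases h1 with h1 | ⟨h1, h1'⟩ | ⟨h1, h1'⟩ | ⟨h1, h1'⟩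
    · simp only [h1, true_or, or_true]
    all_goals
      rcases h2 with h2 | ⟨h2, h2'⟩ | ⟨h2, h2'⟩ | ⟨h2, h2'⟩ <;>
      simp only [*, and_self, true_or, or_true]
  have h1 : C1.card ≤ ∑ p ∈ W ×ˢ W,
      ((nb G L p.1 ×ˢ nb G L p.2).filter fun q => q.1 ≠ q.2).card := by
    refine card_le_sum_card (S := C1) (fun p => (p.1, p.2.2.2)) (fun p => (p.2.1, p.2.2.1))
      (W ×ˢ W) (fun p => (nb G L p.1 ×ˢ nb G L p.2).filter fun q => q.1 ≠ q.2) ?_ ?_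
    · exact fun p _ q _ h h' => quad_ext (Prod.mk.inj h).1 (Prod.mk.inj h').1
        (Prod.mk.inj h').2 (Prod.mk.inj h).2
    · rintro ⟨x, u, v, y⟩ h
      simp only [C1, Finset.mem_filter, F, mem_fourPaths] at h
      simp [mem_nb, h, h.1.2.1.ne, h.1.2.2.1.symm]
  have h2 : C2.card ≤ ∑ p ∈ W ×ˢ W,
      (((nb G L p.1 ∩ nb G L p.2) ×ˢ nb G L p.2).filter fun q => q.1 ≠ q.2).card := by
    refine card_le_sum_card (S := C2) (fun p => (p.1, p.2.2.1)) (fun p => (p.2.1, p.2.2.2))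
      (W ×ˢ W)
      (fun p => ((nb G L p.1 ∩ nb G L p.2) ×ˢ nb G L p.2).filter fun q => q.1 ≠ q.2) ?_ ?_
    · exact fun p _ q _ h h' => quad_ext (Prod.mk.inj h).1 (Prod.mk.inj h').1
        (Prod.mk.inj h).2 (Prod.mk.inj h').2
    · rintro ⟨x, u, v, y⟩ h
      simp only [C2, Finset.mem_filter, F, mem_fourPaths] at h
      simp [mem_nb, h, h.1.2.1.symm]
  have h3 : C3.card ≤ ∑ p ∈ W ×ˢ W,
      (((nb G L p.1 ∩ nb G L p.2) ×ˢ nb G L p.2).filter fun q => q.1 ≠ q.2).card := by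
    refine card_le_sum_card (S := C3) (fun p => (p.2.2.2, p.2.1)) (fun p => (p.2.2.1, p.1))
      (W ×ˢ W)
      (fun p => ((nb G L p.1 ∩ nb G L p.2) ×ˢ nb G L p.2).filter fun q => q.1 ≠ q.2) ?_ ?_
    · exact fun p _ q _ h h' => quad_ext (Prod.mk.inj h').2 (Prod.mk.inj h).2
        (Prod.mk.inj h').1 (Prod.mk.inj h).1
    · rintro ⟨x, u, v, y⟩ h
      simp only [C3, Finset.mem_filter, F, mem_fourPaths] at h
      simp [mem_nb, h, h.1.1.symm, h.1.2.2.1.symm, h.1.2.2.2.1.symm]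
  have h4 : C4.card ≤ ∑ p ∈ W ×ˢ W,
      (nb G L p.1 ∩ nb G L p.2).card * dg G W p.2 := by
    have := card_le_sum_card (S := C4) (fun p => (p.1, p.2.2.1)) (fun p => (p.2.1, p.2.2.2))
      (W ×ˢ W) (fun p => (nb G L p.1 ∩ nb G L p.2) ×ˢ nb G W p.2) ?_ ?_
    · simpa only [Finset.card_product, card_nb] using this
    · exact fun p _ q _ h h' => quad_ext (Prod.mk.inj h).1 (Prod.mk.inj h').1
        (Prod.mk.inj h).2 (Prod.mk.inj h').2
    · rintro ⟨x, u, v, y⟩ h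
      simp only [C4, Finset.mem_filter, F, mem_fourPaths] at h
      simp [mem_nb, h, h.1.2.1.symm]
  have h5 : C5.card ≤ ∑ p ∈ W ×ˢ W,
      (nb G L p.1 ∩ nb G L p.2).card * dg G W p.2 := by
    have := card_le_sum_card (S := C5) (fun p => (p.2.2.2, p.2.1)) (fun p => (p.2.2.1, p.1))
      (W ×ˢ W) (fun p => (nb G L p.1 ∩ nb G L p.2) ×ˢ nb G W p.2) ?_ ?_
    · simpa only [Finset.card_product, card_nb] using this
    · exact fun p _ q _ h h' => quad_ext (Prod.mk.inj h').2 (Prod.mk.inj h).2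
        (Prod.mk.inj h').1 (Prod.mk.inj h).1
    · rintro ⟨x, u, v, y⟩ h
      simp only [C5, Finset.mem_filter, F, mem_fourPaths] at h
      simp [mem_nb, h, h.1.1.symm, h.1.2.2.1.symm]
  have h6 : C6.card ≤ D ^ 2 * (darts G).card := by
    have := card_le_sum_card (S := C6) (fun p => (p.2.1, p.2.2.1)) (fun p => (p.1, p.2.2.2))
      ((darts G).filter fun p => p.1 ∈ W ∧ p.2 ∈ W)
      (fun p => nb G Finset.univ p.1 ×ˢ nb G Finset.univ p.2) ?_ ?_
    · refine this.trans ?_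
      refine (Finset.sum_le_card_nsmul _ _ (D ^ 2) ?_).trans ?_
      · rintro ⟨u, v⟩ h
        rw [Finset.mem_filter] at h
        rw [Finset.card_product, card_nb, card_nb, sq]
        exact Nat.mul_le_mul (hD _ h.2.1) (hD _ h.2.2)
      · rw [smul_eq_mul, mul_comm]
        exact Nat.mul_le_mul le_rfl (Finset.card_filter_le _ _)
    · exact fun p _ q _ h h' => quad_ext (Prod.mk.inj h').1 (Prod.mk.inj h).1
        (Prod.mk.inj h).2 (Prod.mk.inj h').2
    · rintro ⟨x, u, v, y⟩ h
      simp only [C6, Finset.mem_filter, F, mem_fourPaths] at h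
      simp [mem_nb, darts, h, h.1.1.symm]
  have h7 : C7.card ≤ bad.card * (darts G).card := by
    have := card_le_sum_card (S := C7) (fun p => (p.1, p.2.1)) (fun p => (p.2.2.1, p.2.2.2))
      bad (fun _ => darts G) ?_ ?_
    · simpa using this
    · exact fun p _ q _ h h' => quad_ext (Prod.mk.inj h).1 (Prod.mk.inj h).2
        (Prod.mk.inj h').1 (Prod.mk.inj h').2
    · rintro ⟨x, u, v, y⟩ h
      simp only [C7, Finset.mem_filter, F, mem_fourPaths] at h
      simp [darts, h]
  have h8 : C8.card ≤ bad.card * (darts G).card := by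
    have := card_le_sum_card (S := C8) (fun p => (p.2.2.2, p.2.2.1)) (fun p => (p.1, p.2.1))
      bad (fun _ => darts G) ?_ ?_
    · simpa using this
    · exact fun p _ q _ h h' => quad_ext (Prod.mk.inj h').1 (Prod.mk.inj h').2
        (Prod.mk.inj h).2 (Prod.mk.inj h).1
    · rintro ⟨x, u, v, y⟩ h
      simp only [C8, Finset.mem_filter, F, mem_fourPaths] at h
      simp [darts, h]
  have hu := (Finset.card_le_card hcov).trans (Finset.card_union_le _ _)
  have hu2 := Finset.card_union_le C2 (C3 ∪ (C4 ∪ (C5 ∪ (C6 ∪ (C7 ∪ C8)))))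
  have hu3 := Finset.card_union_le C3 (C4 ∪ (C5 ∪ (C6 ∪ (C7 ∪ C8))))
  have hu4 := Finset.card_union_le C4 (C5 ∪ (C6 ∪ (C7 ∪ C8)))
  have hu5 := Finset.card_union_le C5 (C6 ∪ (C7 ∪ C8))
  have hu6 := Finset.card_union_le C6 (C7 ∪ C8)
  have hu7 := Finset.card_union_le C7 C8
  rw [Finset.sum_add_distrib, ← Finset.mul_sum, Finset.sum_add_distrib]
  have hF : F.card = (fourPaths G).card := rfl
  omega

/-- The number of paths in terms of weights of the vertices. -/
theorem card_fourPaths_add_le {t : ℕ} (ht : 2 ≤ t) {L Z W : Finset V} (hW : W = (L ∪ Z)ᶜ) {D : ℕ}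
    (hD : ∀ x ∈ W, dg G Finset.univ x ≤ D) {bad : Finset (V × V)}
    (hbad : ∀ x u, G.Adj x u → (x, u) ∈ bad ∨ (x ∈ W ∧ u ∈ W) ∨ (x ∈ W ∧ u ∈ L) ∨
      (x ∈ L ∧ u ∈ W)) :
    (fourPaths G).card +
      ((W ×ˢ W).filter fun p => dg G L p.1 = t ∧ dg G L p.2 = t ∧
        (nb G L p.1 ∩ nb G L p.2).card < t).card ≤
      W.card * ∑ x ∈ W, (pairWeight (dg G L x) + 2 * dg G L x * dg G W x) +
      D ^ 2 * (darts G).card + 2 * (bad.card * (darts G).card) := by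
  have h := card_fourPaths_le hW hD hbad
  set M := W.card * ∑ x ∈ W, (pairWeight (dg G L x) + 2 * dg G L x * dg G W x) with hM
  let w : V → ℕ := fun x => pairWeight (dg G L x) + 2 * dg G L x * dg G W x
  let c1 : V × V → ℕ := fun p => ((nb G L p.1 ×ˢ nb G L p.2).filter fun q => q.1 ≠ q.2).card
  let c2 : V × V → ℕ := fun p =>
    (((nb G L p.1 ∩ nb G L p.2) ×ˢ nb G L p.2).filter fun q => q.1 ≠ q.2).card +
      (nb G L p.1 ∩ nb G L p.2).card * dg G W p.2
  let δ : V × V → ℕ := fun p => if dg G L p.1 = t ∧ dg G L p.2 = t ∧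
        (nb G L p.1 ∩ nb G L p.2).card < t then 1 else 0
  have hswap : ∑ p ∈ W ×ˢ W, c2 p = ∑ p ∈ W ×ˢ W, c2 p.swap := by
    rw [Finset.sum_product, Finset.sum_product_right]
    rfl
  have hw : ∑ p ∈ W ×ˢ W, (w p.1 + w p.2) = 2 * M := by
    rw [Finset.sum_add_distrib, Finset.sum_product, Finset.sum_product_right]
    simp only [Finset.sum_const, smul_eq_mul, ← Finset.mul_sum]
    rw [hM]; ring
  -- Symmetrising `c2` makes the bound pointwise. The three conditions `q.1 ≠ q.2` each remove `i`
  -- choices, which after doubling is the `6 * i` of `pairWeight_bound`.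
  have hpt : ∀ p ∈ W ×ˢ W, 2 * (c1 p + c2 p + c2 p.swap) + 2 * δ p ≤ w p.1 + w p.2 := by
    rintro ⟨x, y⟩ -
    have e1 := card_filter_ne_product (nb G L x) (nb G L y)
    have e2 := card_filter_ne_product (nb G L x ∩ nb G L y) (nb G L y)
    have e3 := card_filter_ne_product (nb G L y ∩ nb G L x) (nb G L x)
    rw [Finset.inter_eq_left.2 Finset.inter_subset_right] at e2 e3
    have hb := pairWeight_bound (s := dg G L x) (s' := dg G L y)
      (i := (nb G L x ∩ nb G L y).card) ht (Finset.card_le_card Finset.inter_subset_left)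
      (Finset.card_le_card Finset.inter_subset_right)
    rw [Finset.inter_comm (nb G L y)] at e3
    simp only [c1, c2, δ, w, Prod.swap, Finset.inter_comm (nb G L y) (nb G L x)]
    simp only [card_nb] at e1 e2 e3
    have hi1 : (nb G L x ∩ nb G L y).card * dg G W x ≤ dg G L x * dg G W x :=
      Nat.mul_le_mul (Finset.card_le_card Finset.inter_subset_left) le_rfl
    have hi2 : (nb G L x ∩ nb G L y).card * dg G W y ≤ dg G L y * dg G W y :=
      Nat.mul_le_mul (Finset.card_le_card Finset.inter_subset_right) le_rfl
    rw [mul_assoc 2, mul_assoc 2]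
    omega
  have hsum := Finset.sum_le_sum hpt
  rw [hw, Finset.sum_add_distrib, ← Finset.mul_sum, ← Finset.mul_sum, Finset.sum_add_distrib,
    Finset.sum_add_distrib, ← hswap] at hsum
  rw [Finset.card_filter]
  rw [Finset.sum_add_distrib, ← Finset.mul_sum] at h
  simp only [c1, c2, δ] at hsum
  omega

end Counting

/-! ### Stability: a hub set in nearly extremal graphs -/

section Stability

variable {V : Type*} [DecidableEq V] [Fintype V] {G : SimpleGraph V} [DecidableRel G.Adj]

theorem card_darts_le {K : ℕ} (h : NoPath G (K + 1)) :
    (darts G).card ≤ 2 * K * Fintype.card V := by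
  rw [card_darts]
  exact sum_dg_le_of_noPath h Finset.univ

/-- The edges of `G` split with respect to few exceptional edges. -/
theorem exists_exceptional_edges {t : ℕ} (h : NoPath G (2 * t + 3)) {L Z W : Finset V}
    (hW : W = (L ∪ Z)ᶜ) {m : ℕ} (hm : ∑ x ∈ Z, dg G W x ≤ m) :
    ∃ bad : Finset (V × V), bad.card ≤ 2 * (2 * t + 2) * (L ∪ Z).card + 2 * m ∧
      ∀ x u, G.Adj x u → (x, u) ∈ bad ∨ (x ∈ W ∧ u ∈ W) ∨ (x ∈ W ∧ u ∈ L) ∨ (x ∈ L ∧ u ∈ W) := by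
  let B1 := ((L ∪ Z) ×ˢ (L ∪ Z)).filter fun p => G.Adj p.1 p.2
  let B2 := (Z ×ˢ W).filter fun p => G.Adj p.1 p.2
  let B3 := (W ×ˢ Z).filter fun p => G.Adj p.2 p.1
  have h1 : B1.card ≤ 2 * (2 * t + 2) * (L ∪ Z).card := by
    refine le_trans (le_of_eq ?_) (sum_dg_le_of_noPath (K := 2 * t + 2) h (L ∪ Z))
    simp only [B1, dg, Finset.card_filter, Finset.sum_product]
  have h2 : B2.card ≤ m := by
    refine le_trans (le_of_eq ?_) hm
    simp only [B2, dg, Finset.card_filter, Finset.sum_product]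
  have h3 : B3.card ≤ m := by
    refine le_trans (le_of_eq ?_) hm
    simp only [B3, dg, Finset.card_filter, Finset.sum_product_right]
  refine ⟨B1 ∪ (B2 ∪ B3), ?_, ?_⟩
  · have := Finset.card_union_le B1 (B2 ∪ B3)
    have := Finset.card_union_le B2 B3
    omega
  · intro x u hxu
    have hc : ∀ v, v ∈ W ∨ v ∈ L ∪ Z := by
      intro v
      rw [hW, Finset.mem_compl]
      tauto
    have hux := hxu.symm
    rcases hc x with hx | hx <;> rcases hc u with hu | hu
    · tauto
    · rcases Finset.mem_union.1 hu with hu | hu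
      · tauto
      · left; simp [B3, hx, hu, hux]
    · rcases Finset.mem_union.1 hx with hx | hx
      · tauto
      · left; simp [B2, hx, hu, hxu]
    · left
      exact Finset.mem_union_left _ (Finset.mem_filter.2 ⟨Finset.mem_product.2 ⟨hx, hu⟩, hxu⟩)

omit [DecidableEq V] [Fintype V] in
/-- If a function on pairs is small on average, then it has a small fibre. -/
theorem exists_small_fiber {W : Finset V} (hW : W.Nonempty) (S : V × V → Prop) [DecidablePred S] :
    ∃ x ∈ W, W.card * (W.filter fun y => S (x, y)).card ≤ ((W ×ˢ W).filter S).card := by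
  have : ((W ×ˢ W).filter S).card = ∑ x ∈ W, (W.filter fun y => S (x, y)).card := by
    simp only [Finset.card_filter, Finset.sum_product]
  rw [this]
  obtain ⟨x, hx, hmin⟩ := Finset.exists_min_image W (fun x => (W.filter fun y => S (x, y)).card) hW
  refine ⟨x, hx, ?_⟩
  rw [← smul_eq_mul]
  exact Finset.card_nsmul_le_sum _ _ _ hmin

/-- The constant in the stability theorem. -/
def stabilityConst (t : ℕ) : ℕ := 8 * (4 * (2 * t + 2) * (4 * t + 6) + 2) + 1

/-- The deficit bounds the ordered pairs in `W` that fail to have the same `t` neighbours in `L`. By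
averaging, some `x` is in few bad pairs, and its neighbourhood in `L` serves as `A`. -/
theorem exists_hub_set_of_weights {t M : ℕ} (hM : stabilityConst t < M) {L W : Finset V}
    (hn : 0 < Fintype.card V) (hWn : M * Fintype.card V ≤ M * W.card + Fintype.card V)
    (hsum : M * (((W ×ˢ W).filter fun p => dg G L p.1 = t ∧ dg G L p.2 = t ∧
        (nb G L p.1 ∩ nb G L p.2).card < t).card + W.card * (W.filter fun x => dg G L x < t).card) ≤
        (4 * (2 * t + 2) * (4 * t + 6) + 2) * Fintype.card V ^ 2)
    (hWt : ∀ x ∈ W, dg G L x ≤ t) :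
    ∃ A : Finset V, A.card = t ∧ M * Fintype.card V ≤
      M * (Finset.univ.filter fun x => ∀ a ∈ A, G.Adj x a).card +
        stabilityConst t * Fintype.card V := by
  set n := Fintype.card V
  set c := 4 * (2 * t + 2) * (4 * t + 6) + 2 with hc
  have hcM : stabilityConst t = 8 * c + 1 := rfl
  have hW2 : n ≤ 2 * W.card := by
    by_contra! hlt
    have : 2 ≤ M := by omega
    nlinarith
  have hWne : W.Nonempty := by
    rw [← Finset.card_pos]; omega
  let S : V × V → Prop := fun p => ¬ (dg G L p.1 = t ∧ dg G L p.2 = t ∧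
    t ≤ (nb G L p.1 ∩ nb G L p.2).card)
  obtain ⟨x, hx, hfib⟩ := exists_small_fiber hWne S
  set N := (W.filter fun y => S (x, y)).card with hN
  have hS : ((W ×ˢ W).filter S).card ≤
      ((W ×ˢ W).filter fun p => dg G L p.1 = t ∧ dg G L p.2 = t ∧
        (nb G L p.1 ∩ nb G L p.2).card < t).card +
      2 * (W.card * (W.filter fun x => dg G L x < t).card) := by
    have hsub : (W ×ˢ W).filter S ⊆ ((W ×ˢ W).filter fun p => dg G L p.1 = t ∧ dg G L p.2 = t ∧
        (nb G L p.1 ∩ nb G L p.2).card < t) ∪ (W ×ˢ (W.filter fun x => dg G L x < t) ∪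
          (W.filter fun x => dg G L x < t) ×ˢ W) := by
      rintro ⟨y, z⟩ hp
      simp only [S, Finset.mem_filter, Finset.mem_product, Finset.mem_union] at hp ⊢
      have h1 := hWt y hp.1.1
      have h2 := hWt z hp.1.2
      have h3 := hp.2
      simp only [hp.1, true_and, and_true]
      by_contra! hcon
      apply h3
      omega
    have h1 := Finset.card_le_card hsub
    have h2 := (Finset.card_union_le ((W ×ˢ W).filter fun p => dg G L p.1 = t ∧ dg G L p.2 = t ∧
        (nb G L p.1 ∩ nb G L p.2).card < t) (W ×ˢ (W.filter fun x => dg G L x < t) ∪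
          (W.filter fun x => dg G L x < t) ×ˢ W))
    have h3 := Finset.card_union_le (W ×ˢ (W.filter fun x => dg G L x < t))
          ((W.filter fun x => dg G L x < t) ×ˢ W)
    rw [Finset.card_product, Finset.card_product, mul_comm _ W.card] at h3
    omega
  have hMN : M * N ≤ 4 * c * n := by
    have h1 : M * (W.card * N) ≤ 2 * (c * n ^ 2) := by
      calc M * (W.card * N) ≤ M * ((W ×ˢ W).filter S).card := Nat.mul_le_mul le_rfl hfib
        _ ≤ M * _ := Nat.mul_le_mul le_rfl hS
        _ ≤ 2 * (M * (((W ×ˢ W).filter fun p => dg G L p.1 = t ∧ dg G L p.2 = t ∧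
        (nb G L p.1 ∩ nb G L p.2).card < t).card +
          W.card * (W.filter fun x => dg G L x < t).card)) := by
          rw [Nat.mul_add, Nat.mul_add]; 
          have := Nat.zero_le (M * ((W ×ˢ W).filter fun p => dg G L p.1 = t ∧ dg G L p.2 = t ∧
            (nb G L p.1 ∩ nb G L p.2).card < t).card)
          nlinarith
        _ ≤ _ := Nat.mul_le_mul le_rfl hsum
    have h2 : n * (M * N) ≤ n * (4 * c * n) := by
      calc n * (M * N) ≤ (2 * W.card) * (M * N) := Nat.mul_le_mul hW2 le_rfl
        _ = 2 * (M * (W.card * N)) := by ring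
        _ ≤ 2 * (2 * (c * n ^ 2)) := Nat.mul_le_mul le_rfl h1
        _ = _ := by ring
    exact Nat.le_of_mul_le_mul_left h2 hn
  have hsplit := Finset.card_filter_add_card_filter_not (s := W) (fun y => S (x, y))
  rw [← hN] at hsplit
  have hmany : M * n ≤ M * (W.filter fun y => ¬ S (x, y)).card + (4 * c + 1) * n := by
    calc M * n ≤ M * W.card + n := hWn
      _ = M * (W.filter fun y => ¬ S (x, y)).card + M * N + n := by rw [← hsplit]; ring
      _ ≤ _ := by nlinarith
  have hpos : 0 < (W.filter fun y => ¬ S (x, y)).card := by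
    refine Nat.pos_of_ne_zero fun h0 => ?_
    rw [h0] at hmany
    nlinarith
  obtain ⟨y0, hy0⟩ := Finset.card_pos.1 hpos
  have hxt : dg G L x = t := by
    have := (Finset.mem_filter.1 hy0).2
    simp only [S, not_not] at this
    exact this.1
  refine ⟨nb G L x, hxt, ?_⟩
  have hsub : (W.filter fun y => ¬ S (x, y)) ⊆
      Finset.univ.filter fun y => ∀ a ∈ nb G L x, G.Adj y a := by
    intro y hy
    simp only [S, not_not, Finset.mem_filter, Finset.mem_univ, true_and] at hy ⊢
    have heq : nb G L x ∩ nb G L y = nb G L x :=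
      Finset.eq_of_subset_of_card_le Finset.inter_subset_left
        (by rw [card_nb, hxt]; exact hy.2.2.2)
    intro a ha
    rw [← heq, Finset.mem_inter] at ha
    exact (mem_nb.1 ha.2).2
  have := Nat.mul_le_mul (le_refl M) (Finset.card_le_card hsub)
  rw [hcM]
  nlinarith

/-- Stability: an almost extremal graph without paths on `2 * t + 3` vertices has `t` vertices
that have almost all vertices as their common neighbours. -/
theorem exists_hub_set {t M : ℕ} (ht : 2 ≤ t) (hM : stabilityConst t < M) :
    ∃ n₀ : ℕ, ∀ (V : Type) [DecidableEq V] [Fintype V] (G : SimpleGraph V) [DecidableRel G.Adj],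
      n₀ ≤ Fintype.card V → NoPath G (2 * t + 3) →
      M * (3 * t * (t - 1) * Fintype.card V ^ 2) ≤
        M * (fourPaths G).card + Fintype.card V ^ 2 →
      ∃ A : Finset V, A.card = t ∧ M * Fintype.card V ≤
        M * (Finset.univ.filter fun x => ∀ a ∈ A, G.Adj x a).card +
          stabilityConst t * Fintype.card V := by
  set K := 2 * t + 2 with hK
  -- With `m = n / M ≥ n / (2M)` this `r` gives `2 * K * n ≤ r * m`, the degree sum required for
  -- sparse cleaning. The degree threshold `D` makes `L₀` so small that `L ∪ Z` still has at most `n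
  -- / M` vertices after the growth by `(2 * t + 4) ^ (r + 1)`.
  set r := 4 * K * M with hr
  set D := (2 * t + 4) ^ (r + 1) * (2 * K) * M with hD
  have hM0 : 0 < M := by omega
  refine ⟨M + D ^ 2 * (2 * K) * M + 1, ?_⟩
  intro V _ _ G _ hn hP hT
  set n := Fintype.card V with hndef
  have hE : (darts G).card ≤ 2 * K * n := card_darts_le hP
  set L₀ := Finset.univ.filter fun x => D ≤ dg G Finset.univ x with hL₀
  have hL₀card : D * L₀.card ≤ 2 * K * n := by
    calc D * L₀.card = ∑ x ∈ L₀, D := by rw [Finset.sum_const, smul_eq_mul, mul_comm]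
      _ ≤ ∑ x ∈ L₀, dg G Finset.univ x :=
        Finset.sum_le_sum fun x hx => (Finset.mem_filter.1 hx).2
      _ ≤ ∑ x, dg G Finset.univ x := Finset.sum_le_sum_of_subset (Finset.subset_univ _)
      _ ≤ 2 * K * n := by rw [← card_darts]; exact hE
  set m := n / M with hm
  have hm1 : m * M ≤ n := Nat.div_mul_le_self n M
  have hm2 : n < (m + 1) * M := by
    have := Nat.lt_div_mul_add (a := n) hM0
    rw [← hm] at this
    linarith
  have hnM : M ≤ n := by
    have := Nat.zero_le (D ^ 2 * (2 * K) * M)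
    omega
  have hm0 : 1 ≤ m := (Nat.one_le_div_iff hM0).2 hnM
  have hrm : 2 * K * n ≤ r * m := by
    have : n ≤ 2 * M * m := by nlinarith
    calc 2 * K * n ≤ 2 * K * (2 * M * m) := Nat.mul_le_mul le_rfl this
      _ = r * m := by rw [hr]; ring
  obtain ⟨L, Z, hL, hZL, hcard, hsp, hnot⟩ := exists_sparse_cleaning_set hP m r L₀ (by
    refine le_trans ?_ hrm
    refine (sum_dg_le_of_noPath (K := K) hP _).trans (Nat.mul_le_mul le_rfl ?_)
    exact Finset.card_le_univ _)
  set W := (L ∪ Z)ᶜ with hW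
  have hLZ : M * (L ∪ Z).card ≤ n := by
    have h1 : 2 * K * (M * (L ∪ Z).card) ≤ 2 * K * n := by
      calc 2 * K * (M * (L ∪ Z).card) ≤ 2 * K * (M * ((2 * t + 4) ^ (r + 1) * L₀.card)) :=
            Nat.mul_le_mul le_rfl (Nat.mul_le_mul le_rfl hcard)
        _ = D * L₀.card := by rw [hD]; ring
        _ ≤ _ := hL₀card
    exact Nat.le_of_mul_le_mul_left h1 (by omega)
  have hWcard : W.card + (L ∪ Z).card = n := by
    rw [hW, add_comm]; exact Finset.card_add_card_compl _
  have hWD : ∀ x ∈ W, dg G Finset.univ x ≤ D := by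
    intro x hx
    by_contra! hlt
    have : x ∈ L := hL (Finset.mem_filter.2 ⟨Finset.mem_univ _, hlt.le⟩)
    rw [hW, Finset.mem_compl] at hx
    exact hx (Finset.mem_union_left _ this)
  obtain ⟨bad, hbad1, hbad2⟩ := exists_exceptional_edges hP hW hsp
  have hcount := card_fourPaths_add_le ht hW hWD hbad2
  have hweight := sum_weight_le ht hnot
  rw [← hW] at hweight
  have hWt : ∀ x ∈ W, dg G L x ≤ t := by
    intro x hx
    by_contra! hlt
    refine hnot x ⟨by omega, [], ⟨by simp, by simp⟩, ?_, by simp; omega⟩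
    intro v hv
    rw [List.mem_singleton.1 hv, ← Finset.mem_compl]
    exact hx
  refine exists_hub_set_of_weights (L := L) (W := W) hM (by omega) ?_ ?_ hWt
  · calc M * n = M * W.card + M * (L ∪ Z).card := by rw [← hWcard]; ring
      _ ≤ _ := by omega
  -- Multiplied by `M`, the errors are `n ^ 2` from the assumption, `n ^ 2` from middle edges inside
  -- `W`, and `4 * K * (4 * t + 6) * n ^ 2` from exceptional edges. They add up to the constant that
  -- enters `stabilityConst`.
  · generalize (((W ×ˢ W).filter fun p => dg G L p.1 = t ∧ dg G L p.2 = t ∧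
        (nb G L p.1 ∩ nb G L p.2).card < t).card) = δ at hcount ⊢
    generalize (W.filter fun x => dg G L x < t).card = w at hweight ⊢
    generalize ∑ x ∈ W, (pairWeight (dg G L x) + 2 * dg G L x * dg G W x) = sw at hcount hweight
    have hWn : W.card ≤ n := by omega
    have hb : M * bad.card ≤ (4 * t + 6) * n := by
      calc M * bad.card ≤ M * (2 * (2 * t + 2) * (L ∪ Z).card + 2 * m) :=
            Nat.mul_le_mul le_rfl hbad1
        _ = 2 * (2 * t + 2) * (M * (L ∪ Z).card) + 2 * (m * M) := by ring
        _ ≤ 2 * (2 * t + 2) * n + 2 * n :=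
            Nat.add_le_add (Nat.mul_le_mul le_rfl hLZ) (Nat.mul_le_mul le_rfl hm1)
        _ = _ := by ring
    have hb2 : M * (2 * (bad.card * (darts G).card)) ≤ 4 * K * (4 * t + 6) * n ^ 2 := by
      calc M * (2 * (bad.card * (darts G).card)) = 2 * ((M * bad.card) * (darts G).card) := by ring
        _ ≤ 2 * (((4 * t + 6) * n) * (2 * K * n)) :=
          Nat.mul_le_mul le_rfl (Nat.mul_le_mul hb hE)
        _ = _ := by ring
    have hd2 : M * (D ^ 2 * (darts G).card) ≤ n ^ 2 := by
      calc M * (D ^ 2 * (darts G).card) ≤ M * (D ^ 2 * (2 * K * n)) :=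
            Nat.mul_le_mul le_rfl (Nat.mul_le_mul le_rfl hE)
        _ = (D ^ 2 * (2 * K) * M) * n := by ring
        _ ≤ n * n := Nat.mul_le_mul (by omega) le_rfl
        _ = _ := by ring
    have hw2 : W.card * sw + W.card * w ≤ 3 * t * (t - 1) * n ^ 2 := by
      calc W.card * sw + W.card * w = W.card * (sw + w) := by ring
        _ ≤ n * (3 * t * (t - 1) * n) :=
          Nat.mul_le_mul hWn (hweight.trans (Nat.mul_le_mul le_rfl hWn))
        _ = _ := by ring
    have h3 := Nat.mul_le_mul (le_refl M) hcount
    have h4 := Nat.mul_le_mul (le_refl M) hw2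
    simp only [Nat.mul_add] at h3 h4
    rw [← hK, ← hndef, Nat.mul_add, Nat.add_mul]
    omega

end Stability

/-! ### Edges outside the hub set -/

section Structure

variable {V : Type*} [DecidableEq V] {G : SimpleGraph V} [DecidableRel G.Adj]

omit [DecidableRel G.Adj] in
-- The path grows at its head along `as`, from the last element to the first, with a fresh vertex of
-- `B` before each element: two vertices per step. The set `S` reserves vertices for a path to be
-- joined later.
theorem exists_alternating_path {B : Finset V} (S : Finset V) (as : List V) :
    ∀ (a : V) (r : List V), IsPathList G (a :: r) → (as ++ [a]).Nodup →
    (∀ c ∈ as ++ [a], ∀ b ∈ B, G.Adj b c) → (∀ c ∈ as, c ∉ r) →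
    S.card + 2 * as.length + (a :: r).length < B.card →
    ∃ c l, IsPathList G (c :: l) ∧ [c] <+: (as ++ [a]) ∧
      (c :: l).length = 2 * as.length + (a :: r).length ∧
      ∀ v ∈ c :: l, v ∈ as ∨ v ∈ a :: r ∨ (v ∈ B ∧ v ∉ S) := by
  induction as with
  | nil =>
    intro a r h _ _ _ _
    exact ⟨a, r, h, by simp, by simp, fun v hv => Or.inr (Or.inl hv)⟩
  | cons c as ih =>
    intro a r h hnd hB hr hcard
    simp only [List.length_cons] at hcard
    obtain ⟨d, l, h1, h2, h3, h4⟩ := ih a r h (List.nodup_cons.1 hnd).2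
      (fun e he => hB e (List.mem_cons_of_mem _ he)) (fun e he => hr e (List.mem_cons_of_mem _ he))
      (by simp only [List.length_cons]; omega)
    have hcl : c ∉ d :: l := by
      intro hc
      have hc' : c ∉ as ++ [a] := (List.nodup_cons.1 hnd).1
      rw [List.mem_append, List.mem_singleton] at hc'
      rcases h4 c hc with hc | hc | hc
      · exact hc' (Or.inl hc)
      · rcases List.mem_cons.1 hc with rfl | hc
        · exact hc' (Or.inr rfl)
        · exact hr c (by simp) hc
      · exact G.loopless.irrefl c (hB c (by simp) c hc.1)
    have hlt : (S ∪ (d :: l).toFinset).card < B.card := by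
      have := Finset.card_union_le S (d :: l).toFinset
      have := List.toFinset_card_le (d :: l)
      simp only [List.length_cons] at *
      omega
    obtain ⟨b, hb, hb'⟩ := Finset.exists_mem_notMem_of_card_lt_card hlt
    rw [Finset.mem_union, List.mem_toFinset, not_or] at hb'
    have hd : d ∈ as ++ [a] := h2.subset (by simp)
    have hbc : G.Adj b c := hB c (by simp) b hb
    have hbd : G.Adj b d := hB d (List.mem_cons_of_mem _ hd) b hb
    refine ⟨c, b :: d :: l, (h1.cons hbd hb'.2).cons hbc.symm ?_, by simp, ?_, ?_⟩
    · rw [List.mem_cons, not_or]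
      exact ⟨hbc.ne', hcl⟩
    · simp only [List.length_cons] at *
      omega
    · intro v hv
      rcases List.mem_cons.1 hv with rfl | hv
      · exact Or.inl (by simp)
      rcases List.mem_cons.1 hv with rfl | hv
      · exact Or.inr (Or.inr ⟨hb, hb'.1⟩)
      · rcases h4 v hv with h | h | h
        · exact Or.inl (List.mem_cons_of_mem _ h)
        · exact Or.inr (Or.inl h)
        · exact Or.inr (Or.inr h)

/-- Two disjoint paths outside `A`, attached to different vertices of `A`, are the ends of a path
through all vertices of `A`. -/
theorem length_add_length_lt {A B : Finset V} {m : ℕ} (h : NoPath G m)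
    (hB : ∀ c ∈ A, ∀ b ∈ B, G.Adj b c) {x x' a a' : V} {l l' : List V}
    (hl : IsPathList G (x :: l)) (hl' : IsPathList G (x' :: l')) (ha : a ∈ A) (ha' : a' ∈ A)
    (haa : a ≠ a') (hxa : G.Adj x a) (hxa' : G.Adj x' a') (hlA : Avoids (x :: l) A)
    (hlA' : Avoids (x' :: l') A) (hd : ∀ v ∈ x :: l, v ∉ x' :: l')
    (hcard : (x :: l).length + (x' :: l').length + 2 * A.card < B.card) :
    (x :: l).length + (x' :: l').length + 2 * A.card < m + 1 := by
  set as : List V := a :: ((A.erase a).erase a').toList with has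
  have hmem : ∀ c ∈ as, c ∈ A ∧ c ≠ a' := by
    intro c hc
    rcases List.mem_cons.1 hc with rfl | hc
    · exact ⟨ha, haa⟩
    · rw [Finset.mem_toList, Finset.mem_erase, Finset.mem_erase] at hc
      exact ⟨hc.2.2, hc.1⟩
  have hlen : as.length + 1 = A.card := by
    rw [has, List.length_cons, Finset.length_toList]
    have h1 := Finset.card_erase_add_one ha
    have h2 := Finset.card_erase_add_one (s := A.erase a) (a := a')
      (Finset.mem_erase.2 ⟨haa.symm, ha'⟩)
    omega
  have hP0 : IsPathList G (a' :: x' :: l') := hl'.cons hxa'.symm fun h => hlA' a' h ha'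
  have hnd : (as ++ [a']).Nodup := by
    rw [List.nodup_append']
    refine ⟨List.nodup_cons.2 ⟨by simp, Finset.nodup_toList _⟩, by simp, ?_⟩
    intro c hc hc'
    exact (hmem c hc).2 (List.mem_singleton.1 hc')
  obtain ⟨c, q, h1, h2, h3, h4⟩ := exists_alternating_path (G := G) (B := B) (x :: l).toFinset as a'
    (x' :: l') hP0 hnd (by
      intro c hc
      rcases List.mem_append.1 hc with hc | hc
      · exact hB c (hmem c hc).1
      · rw [List.mem_singleton.1 hc]
        exact hB a' ha')
    (fun c hc hc' => hlA' c hc' (hmem c hc).1) (by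
      have := List.toFinset_card_le (x :: l)
      simp only [List.length_cons] at *
      omega)
  have hca : c = a := by
    simpa [has] using h2
  subst hca
  have hj := hl.join h1 hxa (by
    intro v hv hv'
    rcases h4 v hv' with h | h | h
    · exact hlA v hv (hmem v h).1
    · rcases List.mem_cons.1 h with rfl | h
      · exact hlA v hv ha'
      · exact hd v hv h
    · exact h.2 (List.mem_toFinset.2 hv))
  -- Between the two outer paths lie all of `A` and `A.card - 1` connecting vertices; the bound `m +
  -- 1` avoids this subtraction.
  have := h _ hj
  rw [List.length_append, List.length_reverse, h3] at this
  simp only [List.length_cons] at *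
  omega

/-- A path outside `A` that is attached to `A` is the end of a path through all vertices of `A`. -/
theorem length_add_lt {A B : Finset V} {m : ℕ} (h : NoPath G m)
    (hB : ∀ c ∈ A, ∀ b ∈ B, G.Adj b c) {x a : V} {l : List V}
    (hl : IsPathList G (x :: l)) (ha : a ∈ A) (hA : 2 ≤ A.card)
    (hxa : G.Adj x a) (hlA : Avoids (x :: l) A)
    (hcard : (x :: l).length + 1 + 2 * A.card < B.card) :
    (x :: l).length + 2 * A.card < m := by
  obtain ⟨a', ha', haa⟩ := Finset.exists_mem_ne (s := A) (by omega) a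
  have hlt : (x :: l).toFinset.card < B.card := by
    have := List.toFinset_card_le (x :: l)
    omega
  -- A single unused common neighbour of `A` serves as the second outer path, attached to a vertex
  -- other than `a`.
  obtain ⟨b, hb, hb'⟩ := Finset.exists_mem_notMem_of_card_lt_card hlt
  rw [List.mem_toFinset] at hb'
  have := length_add_length_lt h hB (l' := []) (x' := b) hl ⟨by simp, by simp⟩ ha ha' haa.symm hxa
    (hB a' ha' b hb) hlA ?_ ?_ (by simpa using hcard)
  · simp only [List.length_cons, List.length_nil] at *
    omega
  · intro v hv hvA
    rw [List.mem_singleton.1 hv] at hvA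
    exact G.loopless.irrefl b (hB b hvA b hb)
  · intro v hv hv'
    rw [List.mem_singleton.1 hv'] at hv
    exact hb' hv

/-- The restrictions that a set `A` of `t` vertices with many common neighbours imposes on the
edges outside `A`, in a graph without paths on `2 * t + 3` vertices. -/
structure OuterEdges (G : SimpleGraph V) [DecidableRel G.Adj] (A R : Finset V) : Prop where
  eq_of_adj : ∀ x ∈ R, ∀ y ∈ R, ∀ z ∈ R, 0 < dg G A x → G.Adj x y → G.Adj y z → z = x
  not_disjoint : ∀ x ∈ R, ∀ y ∈ R, ∀ x' ∈ R, ∀ y' ∈ R, ∀ a ∈ A, ∀ a' ∈ A, a ≠ a' → G.Adj x a →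
    G.Adj x' a' → G.Adj x y → G.Adj x' y' → x ≠ x' → x ≠ y' → y ≠ x' → y ≠ y' → False

/-- An outer path attached to `A` has at most two vertices, and two disjoint ones attached at
different vertices of `A` have at most three in total. -/
theorem outerEdges_of_noPath [Fintype V] {A B : Finset V} {t : ℕ} (hA : A.card = t) (ht : 2 ≤ t)
    (h : NoPath G (2 * t + 3)) (hB : ∀ c ∈ A, ∀ b ∈ B, G.Adj b c) (hcard : 2 * t + 4 < B.card) :
    OuterEdges G A Aᶜ where
  eq_of_adj x hx y hy z hz hxA hxy hyz := by
    by_contra hne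
    rw [Finset.mem_compl] at hx hy hz
    obtain ⟨a, ha⟩ := Finset.card_pos.1 hxA
    rw [Finset.mem_filter] at ha
    have hp : IsPathList G [x, y, z] := by
      refine ⟨by simp [hxy, hyz], ?_⟩
      simp [hxy.ne, hyz.ne, Ne.symm hne]
    have := length_add_lt h hB hp ha.1 (by omega) ha.2
      (by intro v hv; simp at hv; rcases hv with rfl | rfl | rfl <;> assumption)
      (by simp; omega)
    simp at this
    omega
  not_disjoint x hx y hy x' hx' y' hy' a ha a' ha' haa hxa hxa' hxy hxy' h1 h2 h3 h4 := by
    rw [Finset.mem_compl] at hx hy hx' hy'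
    have := length_add_length_lt h hB (l := [y]) (l' := [y']) ⟨by simpa using hxy, by simp [hxy.ne]⟩
      ⟨by simpa using hxy', by simp [hxy'.ne]⟩ ha ha' haa hxa hxa'
      (by intro v hv; simp at hv; rcases hv with rfl | rfl <;> assumption)
      (by intro v hv; simp at hv; rcases hv with rfl | rfl <;> assumption)
      (by intro v hv; simp at hv ⊢; rcases hv with rfl | rfl <;> tauto)
      (by simp; omega)
    simp at this
    omega

/-- The vertices of `R` that have a neighbour in `R`. -/
def nonIsolated (G : SimpleGraph V) [DecidableRel G.Adj] (R : Finset V) : Finset V :=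
  R.filter fun x => 0 < dg G R x

omit [DecidableEq V] in
theorem mem_nonIsolated_of_adj {R : Finset V} {x y : V} (hx : x ∈ R) (hy : y ∈ R)
    (hxy : G.Adj x y) : x ∈ nonIsolated G R :=
  Finset.mem_filter.2 ⟨hx, Finset.card_pos.2 ⟨y, Finset.mem_filter.2 ⟨hy, hxy⟩⟩⟩

omit [DecidableEq V] in
theorem exists_adj_of_mem_nonIsolated {R : Finset V} {x : V} (hx : x ∈ nonIsolated G R) :
    x ∈ R ∧ ∃ y ∈ R, G.Adj x y := by
  obtain ⟨h1, h2⟩ := Finset.mem_filter.1 hx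
  obtain ⟨y, hy⟩ := Finset.card_pos.1 h2
  exact ⟨h1, y, Finset.mem_filter.1 hy⟩

omit [DecidableEq V] in
theorem OuterEdges.dg_eq_one {A R : Finset V} (h : OuterEdges G A R) {p q : V} (hp : p ∈ R)
    (hq : q ∈ R) (hpq : G.Adj p q) (hpA : 0 < dg G A p) : dg G R q = 1 := by
  unfold dg
  rw [Finset.card_eq_one]
  refine ⟨p, ?_⟩
  ext y
  simp only [Finset.mem_filter, Finset.mem_singleton]
  constructor
  · rintro ⟨hy, hqy⟩
    exact h.eq_of_adj p hp q hq y hy hpA hpq hqy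
  · rintro rfl
    exact ⟨hp, hpq.symm⟩

/-- Common neighbours are attached to every vertex of `A`, so outer edges at two of them cannot be
disjoint. Hence almost all of `B` is isolated outside `A`. -/
theorem OuterEdges.card_inter_nonIsolated_le {A R B : Finset V} (h : OuterEdges G A R)
    (hA : 2 ≤ A.card) (hB : ∀ c ∈ A, ∀ b ∈ B, G.Adj b c) : (B ∩ nonIsolated G R).card ≤ 2 := by
  have hpos : ∀ b ∈ B, 0 < dg G A b := by
    intro b hb
    obtain ⟨a, ha⟩ := Finset.card_pos.1 (show 0 < A.card by omega)
    exact Finset.card_pos.2 ⟨a, Finset.mem_filter.2 ⟨ha, hB a ha b hb⟩⟩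
  rcases (B ∩ nonIsolated G R).eq_empty_or_nonempty with h0 | ⟨x, hx⟩
  · simp [h0]
  rw [Finset.mem_inter] at hx
  obtain ⟨hxR, y, hyR, hxy⟩ := exists_adj_of_mem_nonIsolated hx.2
  refine (Finset.card_le_card (t := {x, y}) ?_).trans Finset.card_le_two
  intro x' hx'
  rw [Finset.mem_inter] at hx'
  obtain ⟨hxR', y', hyR', hxy'⟩ := exists_adj_of_mem_nonIsolated hx'.2
  by_contra hne
  simp only [Finset.mem_insert, Finset.mem_singleton, not_or] at hne
  obtain ⟨a, ha⟩ := Finset.card_pos.1 (show 0 < A.card by omega)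
  obtain ⟨a', ha', haa⟩ := Finset.exists_mem_ne (s := A) (by omega) a
  refine h.not_disjoint x hxR y hyR x' hxR' y' hyR' a ha a' ha' haa.symm (hB a ha x hx.1)
    (hB a' ha' x' hx'.1) hxy hxy' (Ne.symm hne.1) ?_ (Ne.symm hne.2) ?_
  · rintro rfl
    exact hne.2 (h.eq_of_adj x' hxR' x hxR y hyR (hpos x' hx'.1) hxy' hxy).symm
  · rintro rfl
    exact hne.1 (h.eq_of_adj x hxR y hyR x' hxR' (hpos x hx.1) hxy hxy'.symm)

/-- The edges outside `A` cost more than they contribute. -/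
theorem OuterEdges.sum_charge_le {A R : Finset V} (h : OuterEdges G A R) {t : ℕ}
    (hA : A.card = t) (ht : 2 ≤ t) (h3 : 3 ≤ (nonIsolated G R).card) :
    ∑ q ∈ nonIsolated G R, dg G A q * (3 * (t - 1) + dg G R q) + (nonIsolated G R).card ≤
      3 * t * (t - 1) * (nonIsolated G R).card := by
  classical
  set Y := nonIsolated G R with hY
  obtain ⟨s, rfl⟩ := Nat.exists_eq_add_of_le ht
  rw [show 2 + s - 1 = s + 1 by omega]
  have hα : ∀ q, dg G A q ≤ 2 + s := fun q => hA ▸ dg_le_card A q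
  have hYR : ∀ q ∈ Y, q ∈ R := fun q hq => (exists_adj_of_mem_nonIsolated hq).1
  -- An outer edge `qp` attached at both ends, `q` to two vertices of `A`. Whatever vertex of `A`
  -- another outer edge is attached to, `q` can use a different one, so only `q` and `p` contribute.
  -- The edge `qp` is a component, so `3 ≤ Y.card` forces a second, disjoint edge and four vertices
  -- to pay for the two terms.
  by_cases hII : ∃ q ∈ Y, ∃ p ∈ Y, G.Adj q p ∧ 0 < dg G A p ∧ 2 ≤ dg G A q
  · obtain ⟨q, hq, p, hp, hqp, hpA, hqA⟩ := hII
    have hqA0 : 0 < dg G A q := by omega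
    have hq1 := h.dg_eq_one (hYR p hp) (hYR q hq) hqp.symm hpA
    have hp1 := h.dg_eq_one (hYR q hq) (hYR p hp) hqp hqA0
    have honly : ∀ y ∈ Y, y ≠ q → y ≠ p → ∀ y' ∈ R, G.Adj y y' → y' ≠ q ∧ y' ≠ p := by
      intro y hy hyq hyp y' hy' hyy'
      constructor
      · rintro rfl
        exact hyp (h.eq_of_adj p (hYR p hp) y' hy' y (hYR y hy) hpA hqp.symm hyy'.symm)
      · rintro rfl
        exact hyq (h.eq_of_adj q (hYR q hq) y' hy' y (hYR y hy) hqA0 hqp hyy'.symm)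
    have hzero : ∀ y ∈ Y, y ∉ ({q, p} : Finset V) → dg G A y = 0 := by
      intro y hy hyn
      simp only [Finset.mem_insert, Finset.mem_singleton, not_or] at hyn
      by_contra hne
      obtain ⟨a', ha'⟩ := Finset.card_pos.1 (Nat.pos_of_ne_zero hne)
      rw [Finset.mem_filter] at ha'
      obtain ⟨a, ha, haa⟩ := Finset.exists_mem_ne (s := A.filter (G.Adj q)) hqA a'
      rw [Finset.mem_filter] at ha
      obtain ⟨hyR, y', hyR', hyy'⟩ := exists_adj_of_mem_nonIsolated hy
      obtain ⟨h1, h2⟩ := honly y hy hyn.1 hyn.2 y' hyR' hyy'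
      exact h.not_disjoint q (hYR q hq) p (hYR p hp) y hyR y' hyR' a ha.1 a' ha'.1 haa ha.2 ha'.2
        hqp hyy' (Ne.symm hyn.1) (Ne.symm h1) (Ne.symm hyn.2) (Ne.symm h2)
    have hsub : ({q, p} : Finset V) ⊆ Y := by
      intro y hy
      simp only [Finset.mem_insert, Finset.mem_singleton] at hy
      rcases hy with rfl | rfl <;> assumption
    have hcard2 : ({q, p} : Finset V).card = 2 := Finset.card_pair hqp.ne
    have h4 : 4 ≤ Y.card := by
      obtain ⟨y, hy, hyn⟩ := Finset.exists_mem_notMem_of_card_lt_card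
        (show ({q, p} : Finset V).card < Y.card by omega)
      simp only [Finset.mem_insert, Finset.mem_singleton, not_or] at hyn
      obtain ⟨hyR, y', hyR', hyy'⟩ := exists_adj_of_mem_nonIsolated hy
      obtain ⟨h1, h2⟩ := honly y hy hyn.1 hyn.2 y' hyR' hyy'
      have hc : ({y, y', q, p} : Finset V).card = 4 := by
        rw [Finset.card_insert_of_notMem, Finset.card_insert_of_notMem, hcard2]
        · simp [h1, h2]
        · simp [hyn, hyy'.ne]
      rw [← hc]
      apply Finset.card_le_card
      intro z hz
      simp only [Finset.mem_insert, Finset.mem_singleton] at hz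
      rcases hz with rfl | rfl | rfl | rfl
      · exact hy
      · exact mem_nonIsolated_of_adj hyR' hyR hyy'.symm
      · exact hq
      · exact hp
    rw [← Finset.sum_subset hsub (fun y hy hyn => by rw [hzero y hy hyn, zero_mul]),
      Finset.sum_pair hqp.ne, hq1, hp1]
    have e1 := hα q
    have e2 := hα p
    nlinarith [Nat.mul_le_mul (Nat.zero_le (s * s)) h4]
  · push Not at hII
    set Y1 := Y.filter fun q => 0 < dg G A q with hY1
    set Y0 := Y.filter fun q => ¬ 0 < dg G A q with hY0
    have hsplit := Finset.card_filter_add_card_filter_not (s := Y) (fun q => 0 < dg G A q)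
    rw [← hY1, ← hY0] at hsplit
    have hsum0 : ∑ q ∈ Y, dg G A q * (3 * (s + 1) + dg G R q) =
        ∑ q ∈ Y1, dg G A q * (3 * (s + 1) + dg G R q) := by
      rw [← Finset.sum_filter_add_sum_filter_not Y (fun q => 0 < dg G A q)]
      rw [Finset.sum_eq_zero (s := Y.filter fun q => ¬ 0 < dg G A q), add_zero]
      intro q hq
      have := (Finset.mem_filter.1 hq).2
      rw [Nat.eq_zero_of_not_pos this, zero_mul]
    -- Otherwise an attached `q` with an attached outer neighbour has one neighbour in `A` and one
    -- outer neighbour. If all outer neighbours of `q` are unattached, they contribute nothing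
    -- themselves and pass their surplus `3t(t-1) - 1` to `q`; by `hswap` none is charged twice.
    have hcharge : ∀ q ∈ Y1, dg G A q * (3 * (s + 1) + dg G R q) + 1 ≤
        3 * (2 + s) * (s + 1) + (3 * (2 + s) * (s + 1) - 1) * dg G Y0 q := by
      intro q hq
      obtain ⟨hqY, hqA⟩ := Finset.mem_filter.1 hq
      obtain ⟨D, hD⟩ : ∃ D, 3 * (2 + s) * (s + 1) = D + 1 := ⟨3 * s * s + 9 * s + 5, by ring⟩
      have hsD : s + 3 ≤ D := by nlinarith
      by_cases hp : ∃ p ∈ Y, G.Adj q p ∧ 0 < dg G A p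
      · obtain ⟨p, hp, hqp, hpA⟩ := hp
        have h1 := hII q hqY p hp hqp hpA
        have h2 := h.dg_eq_one (hYR p hp) (hYR q hqY) hqp.symm hpA
        have h3 : dg G A q = 1 := by omega
        rw [h2, h3]
        have : 1 * (3 * (s + 1) + 1) + 1 ≤ 3 * (2 + s) * (s + 1) := by nlinarith
        omega
      · push Not at hp
        have hd : dg G R q = dg G Y0 q := by
          unfold dg
          congr 1
          ext y
          simp only [Finset.mem_filter, hY0]
          constructor
          · rintro ⟨hy, hqy⟩
            have hyY := mem_nonIsolated_of_adj hy (hYR q hqY) hqy.symm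
            exact ⟨⟨hyY, by have := hp y hyY hqy; omega⟩, hqy⟩
          · rintro ⟨⟨hy, -⟩, hqy⟩
            exact ⟨hYR y hy, hqy⟩
        have hd1 : 1 ≤ dg G Y0 q := by
          rw [← hd]; exact (Finset.mem_filter.1 hqY).2
        rw [hd]
        have e1 := hα q
        generalize dg G Y0 q = ℓ at *
        calc dg G A q * (3 * (s + 1) + ℓ) + 1 ≤ (2 + s) * (3 * (s + 1) + ℓ) + 1 :=
              Nat.add_le_add_right (Nat.mul_le_mul e1 le_rfl) _
          _ ≤ 3 * (2 + s) * (s + 1) + (s + 3) * ℓ := by nlinarith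
          _ ≤ _ := by
            rw [hD, Nat.add_sub_cancel]
            exact Nat.add_le_add_left (Nat.mul_le_mul hsD le_rfl) _
    have hswap : ∑ q ∈ Y1, dg G Y0 q ≤ Y0.card := by
      have e : ∑ q ∈ Y1, dg G Y0 q = ∑ y ∈ Y0, dg G Y1 y := by
        simp only [dg, Finset.card_filter]
        rw [Finset.sum_comm]
        simp only [G.adj_comm]
      rw [e, ← mul_one Y0.card, ← smul_eq_mul]
      refine Finset.sum_le_card_nsmul _ _ 1 fun y hy => ?_
      unfold dg
      rw [Finset.card_le_one]
      intro q hq q' hq'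
      simp only [Finset.mem_filter, hY1] at hq hq'
      have hyY := (Finset.mem_filter.1 hy).1
      exact h.eq_of_adj q' (hYR q' hq'.1.1) y (hYR y hyY) q (hYR q hq.1.1) hq'.1.2 hq'.2.symm hq.2
    have hs := Finset.sum_le_sum hcharge
    rw [Finset.sum_add_distrib, Finset.sum_add_distrib, Finset.sum_const, Finset.sum_const,
      ← Finset.mul_sum, smul_eq_mul, smul_eq_mul, mul_one] at hs
    rw [hsum0]
    have h5 := Nat.mul_le_mul (le_refl (3 * (2 + s) * (s + 1) - 1)) hswap
    obtain ⟨D, hD⟩ : ∃ D, 3 * (2 + s) * (s + 1) = D + 1 := ⟨3 * s * s + 9 * s + 5, by ring⟩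
    rw [hD, Nat.add_sub_cancel] at h5 hs
    rw [hD]
    rw [← hsplit]
    nlinarith

end Structure

/-! ### Comparison with the hub graph -/

section Comparison

variable {V : Type*} [DecidableEq V]

/-- The graph whose edges are all pairs that meet `A`. -/
def hubGraph (A : Finset V) : SimpleGraph V where
  Adj i j := i ≠ j ∧ (i ∈ A ∨ j ∈ A)
  symm := ⟨fun _ _ h => ⟨h.1.symm, h.2.symm⟩⟩
  loopless := ⟨fun _ h => h.1 rfl⟩

omit [DecidableEq V] in
theorem hubGraph_adj {A : Finset V} {i j : V} :
    (hubGraph A).Adj i j ↔ i ≠ j ∧ (i ∈ A ∨ j ∈ A) := Iff.rfl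

instance (A : Finset V) : DecidableRel (hubGraph A).Adj :=
  fun i j => inferInstanceAs (Decidable (i ≠ j ∧ (i ∈ A ∨ j ∈ A)))

variable [Fintype V] (G : SimpleGraph V) [DecidableRel G.Adj]

/-- The paths with four vertices that meet `Y`. -/
def fourPathsThrough (Y : Finset V) : Finset (V × V × V × V) :=
  (fourPaths G).filter fun p => p.1 ∈ Y ∨ p.2.1 ∈ Y ∨ p.2.2.1 ∈ Y ∨ p.2.2.2 ∈ Y

/-- The darts that meet `Y`. -/
def dartsThrough (Y : Finset V) : Finset (V × V) :=
  (darts G).filter fun p => p.1 ∈ Y ∨ p.2 ∈ Y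

variable {G}

/-- No edge at `Y` leaves `A ∪ Y`, so the bound does not involve the number of vertices of `G`. -/
theorem card_dartsThrough_le {K : ℕ} (h : NoPath G (K + 1)) {A Y : Finset V}
    (hAY : Disjoint A Y) (hG : ∀ x y, G.Adj x y → x ∈ A ∨ y ∈ A ∨ (x ∈ Y ∧ y ∈ Y)) :
    (dartsThrough G Y).card ≤ 2 * K * (A.card + Y.card) := by
  have h1 := sum_dg_le_of_noPath h (A ∪ Y)
  refine le_trans ?_ (h1.trans (Nat.mul_le_mul le_rfl (Finset.card_union_le A Y)))
  have : ∑ x ∈ A ∪ Y, dg G (A ∪ Y) x =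
      (((A ∪ Y) ×ˢ (A ∪ Y)).filter fun p => G.Adj p.1 p.2).card := by
    simp only [dg, Finset.card_filter, Finset.sum_product]
  rw [this]
  apply Finset.card_le_card
  rintro ⟨x, y⟩ hp
  simp only [dartsThrough, darts, Finset.mem_filter, Finset.mem_univ, true_and,
    Finset.mem_product, Finset.mem_union] at hp ⊢
  have := hG x y hp.1
  have hx : x ∈ A → x ∉ Y := fun h => Finset.disjoint_left.1 hAY h
  have hy : y ∈ A → y ∉ Y := fun h => Finset.disjoint_left.1 hAY h
  tauto

theorem card_fourPathsThrough_le_two_mul (Y : Finset V) :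
    (fourPathsThrough G Y).card ≤
      2 * ((fourPaths G).filter fun p => p.1 ∈ Y ∨ p.2.1 ∈ Y).card := by
  set F1 := (fourPaths G).filter fun p => p.1 ∈ Y ∨ p.2.1 ∈ Y
  set F2 := (fourPaths G).filter fun p => p.2.2.2 ∈ Y ∨ p.2.2.1 ∈ Y
  have h1 : fourPathsThrough G Y ⊆ F1 ∪ F2 := by
    intro p hp
    simp only [fourPathsThrough, F1, F2, Finset.mem_union, Finset.mem_filter] at hp ⊢
    tauto
  have h2 : F2.card ≤ F1.card := by
    refine Finset.card_le_card_of_injOn (fun p => (p.2.2.2, p.2.2.1, p.2.1, p.1)) ?_ ?_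
    · rintro ⟨x, u, v, y⟩ hp
      simp only [F1, F2, Finset.coe_filter, Set.mem_ofPred_eq, mem_fourPaths] at hp ⊢
      obtain ⟨⟨a, b, c, d, e, f⟩, g⟩ := hp
      exact ⟨⟨c.symm, b.symm, a.symm, f.symm, e.symm, d.symm⟩, g⟩
    · rintro ⟨x, u, v, y⟩ - ⟨x', u', v', y'⟩ - h
      simp only [Prod.mk.injEq] at h ⊢
      tauto
  have h3 := (Finset.card_le_card h1).trans (Finset.card_union_le _ _)
  omega

omit [Fintype V] in
theorem card_filter_ne_mul (A S : Finset V) (hS : S ⊆ A) :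
    ((S ×ˢ A).filter fun p => p.1 ≠ p.2).card = S.card * (A.card - 1) := by
  have := card_filter_ne_product S A
  rw [Finset.inter_eq_left.2 hS] at this
  rw [Nat.mul_sub, mul_one]
  omega

/-- Reversal reduces to paths with one of the first two vertices in `Y`. Only the patterns YAA*,
YA*A, AYA* and YYA* have a free vertex `*`; they give the factor `Fintype.card V`. Any other path is
determined by a dart through `Y` together with two vertices of `A` or a second such dart. -/
theorem card_fourPathsThrough_le {A Y R : Finset V} (hAY : Disjoint A Y) (hYR : Y ⊆ R)
    (hG : ∀ x y, G.Adj x y → x ∈ A ∨ y ∈ A ∨ (x ∈ Y ∧ y ∈ Y)) :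
    (fourPathsThrough G Y).card ≤
      2 * (Fintype.card V * ∑ q ∈ Y, dg G A q * (3 * (A.card - 1) + dg G R q) +
        (dartsThrough G Y).card * (A.card ^ 2 + (dartsThrough G Y).card)) := by
  refine (card_fourPathsThrough_le_two_mul Y).trans (Nat.mul_le_mul le_rfl ?_)
  set F := (fourPaths G).filter fun p => p.1 ∈ Y ∨ p.2.1 ∈ Y
  have hAY' : ∀ x ∈ A, x ∉ Y := fun x hx hy => Finset.disjoint_left.1 hAY hx hy
  let D1 := F.filter fun p => p.1 ∈ Y ∧ p.2.1 ∈ A ∧ p.2.2.1 ∈ A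
  let D2 := F.filter fun p => p.1 ∈ Y ∧ p.2.1 ∈ A ∧ p.2.2.2 ∈ A
  let D3 := F.filter fun p => p.1 ∈ A ∧ p.2.1 ∈ Y ∧ p.2.2.1 ∈ A
  let D4 := F.filter fun p => p.1 ∈ Y ∧ p.2.1 ∈ Y ∧ p.2.2.1 ∈ A
  let D5 := F.filter fun p => p.2.2.1 ∈ A ∧ p.2.2.2 ∈ A
  let D6 := F.filter fun p => p.2.2.1 ∈ Y ∨ p.2.2.2 ∈ Y
  have hcov : F ⊆ D1 ∪ (D2 ∪ (D3 ∪ (D4 ∪ (D5 ∪ D6)))) := by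
    rintro ⟨x, u, v, y⟩ hp
    obtain ⟨hp1, hp2⟩ := Finset.mem_filter.1 hp
    have hp' := mem_fourPaths.1 hp1
    simp only [D1, D2, D3, D4, D5, D6, Finset.mem_union, Finset.mem_filter, hp, true_and]
    by_cases h6 : v ∈ Y ∨ y ∈ Y
    · simp only [h6, or_true]
    push Not at h6
    have hxu := hG x u hp'.1
    have huv := hG u v hp'.2.1
    have hvy := hG v y hp'.2.2.1
    have hx := hAY' x
    have hu := hAY' u
    simp only at hp2
    by_cases hxA : x ∈ A <;> by_cases huA : u ∈ A <;> by_cases hvA : v ∈ A <;>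
      by_cases hyA : y ∈ A <;>
      simp only [hxA, huA, hvA, hyA, h6, true_implies, false_implies, true_and, and_true,
        false_and, and_false, true_or, or_true, false_or, or_false] at * <;>
      simp_all
  set c := A.card - 1
  have hnb : ∀ q, ((nb G A q ×ˢ A).filter fun p => p.1 ≠ p.2).card = dg G A q * c :=
    fun q => card_filter_ne_mul A _ (Finset.filter_subset _ _)
  set n := Fintype.card V with hn
  have h1 : D1.card ≤ ∑ q ∈ Y, dg G A q * c * n := by
    have := card_le_sum_card (S := D1) (fun p => p.1) (fun p => ((p.2.1, p.2.2.1), p.2.2.2)) Y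
      (fun q => ((nb G A q ×ˢ A).filter fun p => p.1 ≠ p.2) ×ˢ Finset.univ) ?_ ?_
    · simpa only [Finset.card_product, hnb, Finset.card_univ] using this
    · exact fun p _ q _ h h' => quad_ext h (Prod.mk.inj (Prod.mk.inj h').1).1
        (Prod.mk.inj (Prod.mk.inj h').1).2 (Prod.mk.inj h').2
    · rintro ⟨x, u, v, y⟩ h
      simp only [D1, F, Finset.mem_filter, mem_fourPaths] at h
      simp [mem_nb, h, h.1.1.2.1.ne]
  have h2 : D2.card ≤ ∑ q ∈ Y, dg G A q * c * n := by
    have := card_le_sum_card (S := D2) (fun p => p.1) (fun p => ((p.2.1, p.2.2.2), p.2.2.1)) Y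
      (fun q => ((nb G A q ×ˢ A).filter fun p => p.1 ≠ p.2) ×ˢ Finset.univ) ?_ ?_
    · simpa only [Finset.card_product, hnb, Finset.card_univ] using this
    · exact fun p _ q _ h h' => quad_ext h (Prod.mk.inj (Prod.mk.inj h').1).1
        (Prod.mk.inj h').2 (Prod.mk.inj (Prod.mk.inj h').1).2
    · rintro ⟨x, u, v, y⟩ h
      simp only [D2, F, Finset.mem_filter, mem_fourPaths] at h
      simp [mem_nb, h]
  have h3 : D3.card ≤ ∑ q ∈ Y, dg G A q * c * n := by
    have := card_le_sum_card (S := D3) (fun p => p.2.1) (fun p => ((p.1, p.2.2.1), p.2.2.2)) Y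
      (fun q => ((nb G A q ×ˢ A).filter fun p => p.1 ≠ p.2) ×ˢ Finset.univ) ?_ ?_
    · simpa only [Finset.card_product, hnb, Finset.card_univ] using this
    · exact fun p _ q _ h h' => quad_ext (Prod.mk.inj (Prod.mk.inj h').1).1 h
        (Prod.mk.inj (Prod.mk.inj h').1).2 (Prod.mk.inj h').2
    · rintro ⟨x, u, v, y⟩ h
      simp only [D3, F, Finset.mem_filter, mem_fourPaths] at h
      simp [mem_nb, h, h.1.1.1.symm]
  have h4 : D4.card ≤ ∑ q ∈ Y, dg G R q * dg G A q * n := by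
    have := card_le_sum_card (S := D4) (fun p => p.2.1) (fun p => ((p.1, p.2.2.1), p.2.2.2)) Y
      (fun q => (nb G R q ×ˢ nb G A q) ×ˢ Finset.univ) ?_ ?_
    · simpa only [Finset.card_product, card_nb, Finset.card_univ] using this
    · exact fun p _ q _ h h' => quad_ext (Prod.mk.inj (Prod.mk.inj h').1).1 h
        (Prod.mk.inj (Prod.mk.inj h').1).2 (Prod.mk.inj h').2
    · rintro ⟨x, u, v, y⟩ h
      simp only [D4, F, Finset.mem_filter, mem_fourPaths] at h
      simp [mem_nb, h, h.1.1.1.symm, hYR h.2.1]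
  have h5 : D5.card ≤ (dartsThrough G Y).card * A.card ^ 2 := by
    have := card_le_sum_card (S := D5) (fun p => (p.1, p.2.1)) (fun p => (p.2.2.1, p.2.2.2))
      (dartsThrough G Y) (fun _ => A ×ˢ A) ?_ ?_
    · simpa only [Finset.card_product, Finset.sum_const, smul_eq_mul, sq] using this
    · exact fun p _ q _ h h' => quad_ext (Prod.mk.inj h).1 (Prod.mk.inj h).2
        (Prod.mk.inj h').1 (Prod.mk.inj h').2
    · rintro ⟨x, u, v, y⟩ h
      simp only [D5, F, Finset.mem_filter, mem_fourPaths] at h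
      simp [dartsThrough, darts, h]
  have h6 : D6.card ≤ (dartsThrough G Y).card * (dartsThrough G Y).card := by
    have := card_le_sum_card (S := D6) (fun p => (p.1, p.2.1)) (fun p => (p.2.2.1, p.2.2.2))
      (dartsThrough G Y) (fun _ => dartsThrough G Y) ?_ ?_
    · simpa only [Finset.sum_const, smul_eq_mul] using this
    · exact fun p _ q _ h h' => quad_ext (Prod.mk.inj h).1 (Prod.mk.inj h).2
        (Prod.mk.inj h').1 (Prod.mk.inj h').2
    · rintro ⟨x, u, v, y⟩ h
      simp only [D6, F, Finset.mem_filter, mem_fourPaths] at h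
      simp [dartsThrough, darts, h]
  have hu := (Finset.card_le_card hcov).trans (Finset.card_union_le _ _)
  have hu2 := Finset.card_union_le D2 (D3 ∪ (D4 ∪ (D5 ∪ D6)))
  have hu3 := Finset.card_union_le D3 (D4 ∪ (D5 ∪ D6))
  have hu4 := Finset.card_union_le D4 (D5 ∪ D6)
  have hu5 := Finset.card_union_le D5 D6
  have hsum : n * ∑ q ∈ Y, dg G A q * (3 * c + dg G R q) =
      3 * ∑ q ∈ Y, dg G A q * c * n + ∑ q ∈ Y, dg G R q * dg G A q * n := by
    rw [Finset.mul_sum, Finset.mul_sum, ← Finset.sum_add_distrib]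
    exact Finset.sum_congr rfl fun q _ => by ring
  rw [hsum, Nat.mul_add]
  omega

/-- Two hubs, one vertex of `Y` and one of `B` can be arranged in six patterns: YAAB, YABA, AYAB and
their reversals. `code4` records the pattern and so keeps the six families disjoint. -/
theorem le_card_fourPathsThrough_hubGraph {A Y B : Finset V} (hAY : Disjoint A Y)
    (hAB : Disjoint A B) (hYB : Disjoint Y B) :
    6 * (A.card * (A.card - 1) * Y.card * B.card) ≤
      (fourPathsThrough (hubGraph A) Y).card := by
  classical
  let P := A.offDiag ×ˢ (Y ×ˢ B)
  have hP : P.card = A.card * (A.card - 1) * Y.card * B.card := by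
    simp only [P, Finset.card_product, Finset.offDiag_card, Nat.mul_sub, mul_one]
    ring
  let code : V → Fin 3 := fun v => if v ∈ A then 0 else if v ∈ Y then 1 else 2
  have hcA : ∀ a ∈ A, code a = 0 := fun a ha => if_pos ha
  have hcY : ∀ y ∈ Y, code y = 1 := fun y hy => by
    simp [code, hy, Finset.disjoint_right.1 hAY hy]
  have hcB : ∀ b ∈ B, code b = 2 := fun b hb => by
    simp [code, Finset.disjoint_right.1 hAB hb, Finset.disjoint_right.1 hYB hb]
  let code4 : V × V × V × V → Fin 3 × Fin 3 × Fin 3 × Fin 3 :=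
    fun p => (code p.1, code p.2.1, code p.2.2.1, code p.2.2.2)
  set T := fourPathsThrough (hubGraph A) Y with hT
  let C : Finset (Fin 3 × Fin 3 × Fin 3 × Fin 3) :=
    {(1, 0, 0, 2), (2, 0, 0, 1), (1, 0, 2, 0), (0, 2, 0, 1), (2, 0, 1, 0), (0, 1, 0, 2)}
  have hC : C.card = 6 := by decide
  have key : ∀ (c : Fin 3 × Fin 3 × Fin 3 × Fin 3) (f : (V × V) × V × V → V × V × V × V),
      Function.Injective f → (∀ a a' y b, a ∈ A → a' ∈ A → a ≠ a' → y ∈ Y → b ∈ B →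
        f ((a, a'), y, b) ∈ T ∧ code4 (f ((a, a'), y, b)) = c) →
      P.card ≤ (T.filter fun p => code4 p = c).card := by
    intro c f hf h
    refine Finset.card_le_card_of_injOn f ?_ hf.injOn
    rintro ⟨⟨a, a'⟩, y, b⟩ hp
    simp only [P, Finset.coe_product, Set.mem_prod, Finset.mem_coe, Finset.mem_offDiag] at hp
    rw [Finset.mem_coe, Finset.mem_filter]
    exact h a a' y b hp.1.1 hp.1.2.1 hp.1.2.2 hp.2.1 hp.2.2
  have hne : ∀ a y b, a ∈ A → y ∈ Y → b ∈ B → a ≠ y ∧ a ≠ b ∧ y ≠ b ∧ y ≠ a ∧ b ≠ a ∧ b ≠ y := by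
    intro a y b ha hy hb
    have h1 := hcA a ha
    have h2 := hcY y hy
    have h3 := hcB b hb
    have e1 : a ≠ y := ne_of_apply_ne code (by rw [h1, h2]; decide)
    have e2 : a ≠ b := ne_of_apply_ne code (by rw [h1, h3]; decide)
    have e3 : y ≠ b := ne_of_apply_ne code (by rw [h2, h3]; decide)
    exact ⟨e1, e2, e3, e1.symm, e2.symm, e3.symm⟩
  have hmain : ∀ c ∈ C, P.card ≤ (T.filter fun p => code4 p = c).card := by
    intro c hc
    simp only [C, Finset.mem_insert, Finset.mem_singleton] at hc
    rcases hc with rfl | rfl | rfl | rfl | rfl | rfl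
    · refine key _ (fun p => (p.2.1, p.1.1, p.1.2, p.2.2)) ?_ ?_
      · rintro ⟨⟨a, a'⟩, y, b⟩ ⟨⟨c, c'⟩, z, d⟩ h
        simp only [Prod.mk.injEq] at h ⊢
        tauto
      · intro a a' y b ha ha' haa hy hb
        have h1 := hne a y b ha hy hb
        have h2 := hne a' y b ha' hy hb
        exact ⟨by simp [hT, fourPathsThrough, mem_fourPaths, hubGraph_adj, ha, ha', hy, haa,
          h1, h2], by simp [code4, hcA a ha, hcA a' ha', hcY y hy, hcB b hb]⟩
    · refine key _ (fun p => (p.2.2, p.1.1, p.1.2, p.2.1)) ?_ ?_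
      · rintro ⟨⟨a, a'⟩, y, b⟩ ⟨⟨c, c'⟩, z, d⟩ h
        simp only [Prod.mk.injEq] at h ⊢
        tauto
      · intro a a' y b ha ha' haa hy hb
        have h1 := hne a y b ha hy hb
        have h2 := hne a' y b ha' hy hb
        exact ⟨by simp [hT, fourPathsThrough, mem_fourPaths, hubGraph_adj, ha, ha', hy, haa,
          h1, h2], by simp [code4, hcA a ha, hcA a' ha', hcY y hy, hcB b hb]⟩
    · refine key _ (fun p => (p.2.1, p.1.1, p.2.2, p.1.2)) ?_ ?_
      · rintro ⟨⟨a, a'⟩, y, b⟩ ⟨⟨c, c'⟩, z, d⟩ h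
        simp only [Prod.mk.injEq] at h ⊢
        tauto
      · intro a a' y b ha ha' haa hy hb
        have h1 := hne a y b ha hy hb
        have h2 := hne a' y b ha' hy hb
        exact ⟨by simp [hT, fourPathsThrough, mem_fourPaths, hubGraph_adj, ha, ha', hy, haa,
          h1, h2], by simp [code4, hcA a ha, hcA a' ha', hcY y hy, hcB b hb]⟩
    · refine key _ (fun p => (p.1.1, p.2.2, p.1.2, p.2.1)) ?_ ?_
      · rintro ⟨⟨a, a'⟩, y, b⟩ ⟨⟨c, c'⟩, z, d⟩ h
        simp only [Prod.mk.injEq] at h ⊢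
        tauto
      · intro a a' y b ha ha' haa hy hb
        have h1 := hne a y b ha hy hb
        have h2 := hne a' y b ha' hy hb
        exact ⟨by simp [hT, fourPathsThrough, mem_fourPaths, hubGraph_adj, ha, ha', hy, haa,
          h1, h2], by simp [code4, hcA a ha, hcA a' ha', hcY y hy, hcB b hb]⟩
    · refine key _ (fun p => (p.2.2, p.1.1, p.2.1, p.1.2)) ?_ ?_
      · rintro ⟨⟨a, a'⟩, y, b⟩ ⟨⟨c, c'⟩, z, d⟩ h
        simp only [Prod.mk.injEq] at h ⊢
        tauto
      · intro a a' y b ha ha' haa hy hb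
        have h1 := hne a y b ha hy hb
        have h2 := hne a' y b ha' hy hb
        exact ⟨by simp [hT, fourPathsThrough, mem_fourPaths, hubGraph_adj, ha, ha', hy, haa,
          h1, h2], by simp [code4, hcA a ha, hcA a' ha', hcY y hy, hcB b hb]⟩
    · refine key _ (fun p => (p.1.1, p.2.1, p.1.2, p.2.2)) ?_ ?_
      · rintro ⟨⟨a, a'⟩, y, b⟩ ⟨⟨c, c'⟩, z, d⟩ h
        simp only [Prod.mk.injEq] at h ⊢
        tauto
      · intro a a' y b ha ha' haa hy hb
        have h1 := hne a y b ha hy hb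
        have h2 := hne a' y b ha' hy hb
        exact ⟨by simp [hT, fourPathsThrough, mem_fourPaths, hubGraph_adj, ha, ha', hy, haa,
          h1, h2], by simp [code4, hcA a ha, hcA a' ha', hcY y hy, hcB b hb]⟩
  calc 6 * (A.card * (A.card - 1) * Y.card * B.card) = C.card • P.card := by
        rw [hC, hP, smul_eq_mul]
    _ ≤ ∑ c ∈ C, (T.filter fun p => code4 p = c).card := Finset.card_nsmul_le_sum _ _ _ hmain
    _ ≤ ∑ c, (T.filter fun p => code4 p = c).card :=
        Finset.sum_le_sum_of_subset (Finset.subset_univ _)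
    _ = T.card := (Finset.card_eq_sum_card_fiberwise fun _ _ => Finset.mem_univ _).symm

/-- If the edges outside `A` cost more than they contribute, then replacing them by all pairs
that meet `A` increases the number of paths. -/
theorem card_fourPaths_lt_hubGraph {A : Finset V} {t K b : ℕ} (hA : A.card = t)
    (h : NoPath G (K + 1))
    (hY : 0 < (nonIsolated G Aᶜ).card)
    (hsum : ∑ q ∈ nonIsolated G Aᶜ, dg G A q * (3 * (t - 1) + dg G Aᶜ q) +
      (nonIsolated G Aᶜ).card ≤ 3 * t * (t - 1) * (nonIsolated G Aᶜ).card)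
    (hb : b ≤ (Aᶜ \ nonIsolated G Aᶜ).card)
    (hn : 3 * t * (t - 1) * Fintype.card V + 2 * K * (t + 1) * t ^ 2 +
      (2 * K * (t + 1)) ^ 2 * (nonIsolated G Aᶜ).card < Fintype.card V + 3 * t * (t - 1) * b) :
    (fourPaths G).card < (fourPaths (hubGraph A)).card := by
  set Y := nonIsolated G Aᶜ with hYdef
  set B := Aᶜ \ Y with hB
  set n := Fintype.card V
  set m := Y.card
  set c := 2 * K * (t + 1)
  have hYA : Y ⊆ Aᶜ := Finset.filter_subset _ _
  have hAY : Disjoint A Y := disjoint_compl_right.mono_right hYA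
  have hAB : Disjoint A B := disjoint_compl_right.mono_right Finset.sdiff_subset
  have hYB : Disjoint Y B := Finset.disjoint_sdiff
  have hG : ∀ x y, G.Adj x y → x ∈ A ∨ y ∈ A ∨ (x ∈ Y ∧ y ∈ Y) := by
    intro x y hxy
    by_cases hx : x ∈ A
    · exact Or.inl hx
    by_cases hy : y ∈ A
    · exact Or.inr (Or.inl hy)
    rw [← Finset.mem_compl] at hx hy
    exact Or.inr (Or.inr ⟨mem_nonIsolated_of_adj hx hy hxy,
      mem_nonIsolated_of_adj hy hx hxy.symm⟩)
  have he := card_dartsThrough_le h hAY hG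
  have h1 := card_fourPathsThrough_le hAY hYA hG
  have h2 := le_card_fourPathsThrough_hubGraph hAY hAB hYB
  rw [hA] at he h1 h2
  have he' : (dartsThrough G Y).card ≤ c * m := by
    refine he.trans ?_
    have : t + m ≤ (t + 1) * m := by nlinarith
    calc 2 * K * (t + m) ≤ 2 * K * ((t + 1) * m) := Nat.mul_le_mul le_rfl this
      _ = _ := by ring
  -- A path avoiding `Y` uses only edges that meet `A`, and these are edges of the hub graph.
  have h3 : ((fourPaths G).filter fun p => ¬ (p.1 ∈ Y ∨ p.2.1 ∈ Y ∨ p.2.2.1 ∈ Y ∨ p.2.2.2 ∈ Y)).card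
      ≤ ((fourPaths (hubGraph A)).filter fun p =>
        ¬ (p.1 ∈ Y ∨ p.2.1 ∈ Y ∨ p.2.2.1 ∈ Y ∨ p.2.2.2 ∈ Y)).card := by
    apply Finset.card_le_card
    rintro ⟨x, u, v, y⟩ hp
    rw [Finset.mem_filter, mem_fourPaths] at hp ⊢
    obtain ⟨⟨e1, e2, e3, e4⟩, e5⟩ := hp
    simp only [not_or] at e5
    refine ⟨⟨⟨e1.ne, ?_⟩, ⟨e2.ne, ?_⟩, ⟨e3.ne, ?_⟩, e4⟩, by simpa only [not_or] using e5⟩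
    · have := hG _ _ e1; tauto
    · have := hG _ _ e2; tauto
    · have := hG _ _ e3; tauto
  have h4 : (fourPathsThrough G Y).card < (fourPathsThrough (hubGraph A) Y).card := by
    refine lt_of_le_of_lt h1 (lt_of_lt_of_le ?_ h2)
    set S := ∑ q ∈ Y, dg G A q * (3 * (t - 1) + dg G Aᶜ q)
    have hS : n * S + n * m ≤ 3 * t * (t - 1) * n * m := by
      calc n * S + n * m = n * (S + m) := by ring
        _ ≤ n * (3 * t * (t - 1) * m) := Nat.mul_le_mul le_rfl hsum
        _ = _ := by ring
    have hE : (dartsThrough G Y).card * (t ^ 2 + (dartsThrough G Y).card) ≤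
        c * t ^ 2 * m + c ^ 2 * m * m := by
      calc _ ≤ (c * m) * (t ^ 2 + c * m) := Nat.mul_le_mul he' (Nat.add_le_add_left he' _)
        _ = _ := by ring
    have hn' : (3 * t * (t - 1) * n + c * t ^ 2 + c ^ 2 * m) * m <
        (n + 3 * t * (t - 1) * b) * m := Nat.mul_lt_mul_of_pos_right hn hY
    have hb' : 3 * t * (t - 1) * b * m ≤ 3 * (t * (t - 1) * m * B.card) := by
      calc 3 * t * (t - 1) * b * m = 3 * (t * (t - 1) * m * b) := by ring
        _ ≤ _ := Nat.mul_le_mul le_rfl (Nat.mul_le_mul le_rfl hb)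
    rw [Nat.add_mul, Nat.add_mul, Nat.add_mul] at hn'
    change 2 * (n * S + _) < 6 * (t * (t - 1) * m * B.card)
    omega
  have e1 := Finset.card_filter_add_card_filter_not (s := fourPaths G)
    (fun p => p.1 ∈ Y ∨ p.2.1 ∈ Y ∨ p.2.2.1 ∈ Y ∨ p.2.2.2 ∈ Y)
  have e2 := Finset.card_filter_add_card_filter_not (s := fourPaths (hubGraph A))
    (fun p => p.1 ∈ Y ∨ p.2.1 ∈ Y ∨ p.2.2.1 ∈ Y ∨ p.2.2.2 ∈ Y)
  simp only [fourPathsThrough] at h4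
  omega

end Comparison

/-! ### Copies of P_3 and four-vertex sequences -/

section Copies

variable {V : Type*} [DecidableEq V] [Fintype V] {G : SimpleGraph V} [DecidableRel G.Adj]

omit [DecidableEq V] [Fintype V] [DecidableRel G.Adj] in
theorem toSubgraph_adj_iff (f : SimpleGraph.Copy (pathOfLength 3) G) (i j : Fin 4) :
    f.toSubgraph.Adj (f i) (f j) ↔ (pathOfLength 3).Adj i j := by
  constructor
  · rintro ⟨i', j', h, hi, hj⟩
    have h' : (pathOfLength 3).Adj i' j' := h
    rwa [f.injective hi, f.injective hj] at h'
  · intro h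
    exact ⟨i, j, h, rfl, rfl⟩

/-- The automorphism that reverses a path. -/
def revPath : SimpleGraph.Copy (pathOfLength 3) (pathOfLength 3) where
  toHom := ⟨Fin.rev, by
    intro i j h
    rw [SimpleGraph.pathGraph_adj] at h ⊢
    rw [Fin.val_rev, Fin.val_rev]
    omega⟩
  injective' := Fin.rev_injective

omit [DecidableEq V] [Fintype V] [DecidableRel G.Adj] in
-- Two copies with the same image differ by an automorphism `σ` of the path on four vertices, which
-- is the identity or the reversal.
theorem toSubgraph_eq_iff (f g : SimpleGraph.Copy (pathOfLength 3) G) :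
    g.toSubgraph = f.toSubgraph ↔ g = f ∨ g = f.comp revPath := by
  constructor
  · intro h
    have hr : ∀ i, ∃ j, f j = g i := by
      intro i
      have hi : g i ∈ g.toSubgraph.verts := ⟨i, trivial, rfl⟩
      rw [h] at hi
      obtain ⟨j, -, hj⟩ := hi
      exact ⟨j, hj⟩
    choose σ hσ using hr
    have hadj : ∀ i j, (pathOfLength 3).Adj i j → (pathOfLength 3).Adj (σ i) (σ j) := by
      intro i j hij
      rw [← toSubgraph_adj_iff f, hσ, hσ, ← h, toSubgraph_adj_iff]
      exact hij
    have hinj : ∀ i j, (σ i).val = (σ j).val → i = j := by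
      intro i j hij
      apply g.injective
      change g i = g j
      rw [← hσ, ← hσ, Fin.ext hij]
    simp only [SimpleGraph.pathGraph_adj] at hadj
    have h01 := hadj 0 1 (by decide)
    have h12 := hadj 1 2 (by decide)
    have h23 := hadj 2 3 (by decide)
    have n02 : (σ 0).val ≠ (σ 2).val := fun h => absurd (hinj 0 2 h) (by decide)
    have n13 : (σ 1).val ≠ (σ 3).val := fun h => absurd (hinj 1 3 h) (by decide)
    have b0 := (σ 0).isLt
    have b1 := (σ 1).isLt
    have b2 := (σ 2).isLt
    have b3 := (σ 3).isLt
    have hcase : ((σ 0).val = 0 ∧ (σ 1).val = 1 ∧ (σ 2).val = 2 ∧ (σ 3).val = 3) ∨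
      ((σ 0).val = 3 ∧ (σ 1).val = 2 ∧ (σ 2).val = 1 ∧ (σ 3).val = 0) := by omega
    rcases hcase with ⟨e0, e1, e2, e3⟩ | ⟨e0, e1, e2, e3⟩
    · left
      apply SimpleGraph.Copy.ext
      intro i
      have : σ i = i := by
        apply Fin.ext
        fin_cases i <;> assumption
      rw [← hσ, this]
    · right
      apply SimpleGraph.Copy.ext
      intro i
      have : σ i = Fin.rev i := by
        apply Fin.ext
        rw [Fin.val_rev]
        fin_cases i <;> assumption
      rw [← hσ, this]
      rfl
  · rintro (rfl | rfl)
    · rfl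
    · apply SimpleGraph.Subgraph.ext
      · ext v
        constructor
        · rintro ⟨i, -, rfl⟩
          exact ⟨Fin.rev i, trivial, rfl⟩
        · rintro ⟨i, -, rfl⟩
          exact ⟨Fin.rev i, trivial, by
            change f (Fin.rev (Fin.rev i)) = _
            rw [Fin.rev_rev]; rfl⟩
      · ext a b
        constructor
        · rintro ⟨i, j, h, rfl, rfl⟩
          exact ⟨Fin.rev i, Fin.rev j, revPath.toHom.map_adj h, rfl, rfl⟩
        · rintro ⟨i, j, h, rfl, rfl⟩
          refine ⟨Fin.rev i, Fin.rev j, revPath.toHom.map_adj h, ?_, ?_⟩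
          · change f (Fin.rev (Fin.rev i)) = _
            rw [Fin.rev_rev]; rfl
          · change f (Fin.rev (Fin.rev j)) = _
            rw [Fin.rev_rev]; rfl

theorem natCard_copy_eq : Nat.card (SimpleGraph.Copy (pathOfLength 3) G) = (fourPaths G).card := by
  rw [← Fintype.card_coe, ← Nat.card_eq_fintype_card]
  have hne : ∀ (f : SimpleGraph.Copy (pathOfLength 3) G) {i j : Fin 4}, i ≠ j → f i ≠ f j :=
    fun f _ _ h => f.injective.ne h
  have hadj : ∀ (f : SimpleGraph.Copy (pathOfLength 3) G) {i j : Fin 4},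
      (pathOfLength 3).Adj i j → G.Adj (f i) (f j) := fun f _ _ h => f.toHom.map_adj h
  refine Nat.card_eq_of_bijective (fun f => ⟨(f 0, f 1, f 2, f 3), ?_⟩) ⟨?_, ?_⟩
  · rw [mem_fourPaths]
    refine ⟨hadj f ?_, hadj f ?_, hadj f ?_, hne f (by decide), hne f (by decide),
      hne f (by decide)⟩ <;> simp [SimpleGraph.pathGraph_adj]
  · intro f g h
    simp only [Subtype.mk.injEq, Prod.mk.injEq] at h
    apply SimpleGraph.Copy.ext
    intro i
    fin_cases i
    · exact h.1
    · exact h.2.1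
    · exact h.2.2.1
    · exact h.2.2.2
  · rintro ⟨⟨x, u, v, y⟩, h⟩
    rw [mem_fourPaths] at h
    obtain ⟨h1, h2, h3, h4, h5, h6⟩ := h
    refine ⟨⟨⟨![x, u, v, y], ?_⟩, ?_⟩, rfl⟩
    · intro i j hij
      rw [SimpleGraph.pathGraph_adj] at hij
      fin_cases i <;> fin_cases j <;> simp at hij <;>
        first | exact h1 | exact h2 | exact h3 | exact h1.symm | exact h2.symm | exact h3.symm
    · intro i j hij
      have e1 := h1.ne
      have e2 := h2.ne
      have e3 := h3.ne
      fin_cases i <;> fin_cases j <;> simp_all [eq_comm]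

/-- Every path with four vertices has two orientations. -/
theorem two_mul_copyCount : 2 * G.copyCount (pathOfLength 3) = (fourPaths G).card := by
  classical
  rw [← natCard_copy_eq, SimpleGraph.copyCount_eq_card_image_copyToSubgraph, Nat.card_eq_fintype_card,
    ← Finset.card_univ, Finset.card_eq_sum_card_image SimpleGraph.Copy.toSubgraph]
  rw [mul_comm, ← smul_eq_mul, ← Finset.sum_const]
  refine Finset.sum_congr rfl fun S hS => ?_
  obtain ⟨f, -, rfl⟩ := Finset.mem_image.1 hS
  have hne : f ≠ f.comp revPath := by
    intro h
    have : f 0 = f 3 := by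
      conv_lhs => rw [h]
      rfl
    exact absurd (f.injective this) (by decide)
  rw [← Finset.card_pair hne]
  congr 1
  ext g
  simp [toSubgraph_eq_iff]

theorem card_fourPaths_le_of_hom {V' : Type*} [DecidableEq V'] [Fintype V'] {H : SimpleGraph V'}
    [DecidableRel H.Adj] (f : V → V') (hf : Function.Injective f)
    (h : ∀ x y, G.Adj x y → H.Adj (f x) (f y)) : (fourPaths G).card ≤ (fourPaths H).card := by
  refine Finset.card_le_card_of_injOn (fun p => (f p.1, f p.2.1, f p.2.2.1, f p.2.2.2)) ?_ ?_
  · rintro ⟨x, u, v, y⟩ hp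
    rw [Finset.mem_coe, mem_fourPaths] at hp
    rw [Finset.mem_coe, mem_fourPaths]
    exact ⟨h _ _ hp.1, h _ _ hp.2.1, h _ _ hp.2.2.1, hf.ne hp.2.2.2.1, hf.ne hp.2.2.2.2.1,
      hf.ne hp.2.2.2.2.2⟩
  · rintro ⟨x, u, v, y⟩ - ⟨x', u', v', y'⟩ - hp
    simp only [Prod.mk.injEq] at hp ⊢
    exact ⟨hf hp.1, hf hp.2.1, hf hp.2.2.1, hf hp.2.2.2⟩

/-- If every edge of `H` is the first or the middle edge of a path with four vertices, then
proper subgraphs of `H` have fewer such paths. -/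
theorem eq_of_le_of_card_fourPaths_le {H : SimpleGraph V} [DecidableRel H.Adj] (hle : G ≤ H)
    (hcard : (fourPaths H).card ≤ (fourPaths G).card)
    (hH : ∀ i j, H.Adj i j → ∃ a b, (j, i, a, b) ∈ fourPaths H ∨ (i, j, a, b) ∈ fourPaths H ∨
      (a, j, i, b) ∈ fourPaths H) : G = H := by
  have hsub : fourPaths G ⊆ fourPaths H := by
    rintro ⟨x, u, v, y⟩ hp
    rw [mem_fourPaths] at hp ⊢
    exact ⟨hle hp.1, hle hp.2.1, hle hp.2.2.1, hp.2.2.2⟩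
  have heq := Finset.eq_of_subset_of_card_le hsub hcard
  refine le_antisymm hle ?_
  intro i j hij
  obtain ⟨a, b, h | h | h⟩ := hH i j hij
  · rw [← heq, mem_fourPaths] at h
    exact h.1.symm
  · rw [← heq, mem_fourPaths] at h
    exact h.1
  · rw [← heq, mem_fourPaths] at h
    exact h.2.1.symm

end Copies

/-! ### The extremal graph: no long path, number of paths -/

section ExtremalGraph

variable {n k t : ℕ}

instance : DecidableRel (extGraph n k t).Adj := fun i j =>
  inferInstanceAs (Decidable (i ≠ j ∧
    ((i.val < k - t ∧ j.val < k - t) ∨ i.val < t ∨ j.val < t)))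

theorem extGraph_adj {i j : Fin n} : (extGraph n k t).Adj i j ↔
    i ≠ j ∧ ((i.val < k - t ∧ j.val < k - t) ∨ i.val < t ∨ j.val < t) := Iff.rfl

/-- The number of vertices of `l` in the independent part exceeds the number of the others by at
most the number of edges of the path between outer vertices, plus one. -/
theorem extGraph_countP_le (hk : k ≤ 2 * t + 2) (l : List (Fin n))
    (h : IsPathList (extGraph n k t) l) :
    l.countP (fun i => decide (t ≤ i.val)) ≤ l.countP (fun i => decide (i.val < t)) +
      (if k = 2 * t + 2 ∧ (∃ i ∈ l, i.val = t) ∧ (∃ i ∈ l, i.val = t + 1) then 1 else 0) +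
      (if ∃ i ∈ l.head?, t ≤ i.val then 1 else 0) := by
  induction l with
  | nil => simp
  | cons x l ih =>
    have ih := ih (h.suffix (List.suffix_cons x l))
    have hx : x ∉ l := (List.nodup_cons.1 h.2).1
    have hmono : (if k = 2 * t + 2 ∧ (∃ i ∈ l, i.val = t) ∧ (∃ i ∈ l, i.val = t + 1) then 1 else 0) ≤
        (if k = 2 * t + 2 ∧ (∃ i ∈ x :: l, i.val = t) ∧ (∃ i ∈ x :: l, i.val = t + 1)
          then 1 else 0) := by
      split_ifs with h1 h2
      · exact le_rfl
      · exfalso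
        apply h2
        obtain ⟨h0, ⟨i, hi, hi'⟩, j, hj, hj'⟩ := h1
        exact ⟨h0, ⟨i, List.mem_cons_of_mem _ hi, hi'⟩, j, List.mem_cons_of_mem _ hj, hj'⟩
      · simp
      · exact le_rfl
    by_cases hxt : x.val < t
    · rw [List.countP_cons_of_neg (by simpa using hxt), List.countP_cons_of_pos (by simpa using hxt)]
      split_ifs at * <;> omega
    · push Not at hxt
      rw [List.countP_cons_of_pos (by simpa using hxt),
        List.countP_cons_of_neg (by simpa using hxt)]
      rw [if_pos (c := ∃ i ∈ (x :: l).head?, t ≤ i.val) ⟨x, by simp, hxt⟩]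
      rcases l with _ | ⟨y, l⟩
      · simp
      have hadj := (List.isChain_cons_cons.1 h.1).1
      rw [extGraph_adj] at hadj
      by_cases hyt : y.val < t
      · rw [if_neg (c := ∃ i ∈ (y :: l).head?, t ≤ i.val) (by simpa using hyt)] at ih
        omega
      -- Adjacent outer vertices both lie in `C`, which forces `k = 2 * t + 2` and `C = {t, t + 1}`.
      -- As `x` is new, the edge inside `C` was not available to the tail, so this step may claim
      -- its bonus.
      · have hne : x.val ≠ y.val := fun e => hadj.1 (Fin.ext e)
        have hk' : k = 2 * t + 2 := by omega
        rw [if_pos (c := k = 2 * t + 2 ∧ (∃ i ∈ x :: y :: l, i.val = t) ∧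
          (∃ i ∈ x :: y :: l, i.val = t + 1))]
        · rw [if_neg (c := k = 2 * t + 2 ∧ (∃ i ∈ y :: l, i.val = t) ∧
            (∃ i ∈ y :: l, i.val = t + 1))] at ih
          · split_ifs at ih <;> omega
          · rintro ⟨-, ⟨i, hi, hi'⟩, j, hj, hj'⟩
            have : x.val = t ∨ x.val = t + 1 := by omega
            rcases this with hxv | hxv
            · exact hx (by rwa [show x = i from Fin.ext (by omega)])
            · exact hx (by rwa [show x = j from Fin.ext (by omega)])
        · have : (x.val = t ∧ y.val = t + 1) ∨ (x.val = t + 1 ∧ y.val = t) := by omega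
          rcases this with ⟨h1, h2⟩ | ⟨h1, h2⟩
          · exact ⟨hk', ⟨x, by simp, h1⟩, y, by simp, h2⟩
          · exact ⟨hk', ⟨y, by simp, h2⟩, x, by simp, h1⟩

theorem extGraph_noPath (hk : k = 2 * t + 1 ∨ k = 2 * t + 2) :
    NoPath (extGraph n k t) (k + 1) := by
  intro l hl
  have h1 := extGraph_countP_le (by omega) l hl
  have h2 : l.countP (fun i => decide (i.val < t)) ≤ t := by
    rw [List.countP_eq_length_filter]
    have hnd : (l.filter fun i => decide (i.val < t)).Nodup := hl.2.filter _
    rw [← List.toFinset_card_of_nodup hnd]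
    calc _ ≤ (Finset.range t).card := by
          refine Finset.card_le_card_of_injOn Fin.val ?_ Fin.val_injective.injOn
          intro i hi
          simp at hi
          simpa using hi.2
      _ = t := Finset.card_range t
  have h3 := List.length_eq_countP_add_countP (fun i : Fin n => decide (i.val < t)) (l := l)
  have h4 : l.countP (fun i => !decide (i.val < t)) = l.countP (fun i => decide (t ≤ i.val)) := by
    congr 1
    ext i
    rcases Nat.lt_or_ge i.val t with h | h <;> simp [h]
  simp only [Bool.not_eq_true, ← Bool.not_eq_true', Bool.decide_eq_true] at h3
  split_ifs at h1 with h5 <;> omega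

/-- A set of `t` vertices and two more vertices can be moved to the first places. -/
theorem exists_equiv_fin {V : Type*} [DecidableEq V] [Fintype V] {A : Finset V} {x y : V}
    (hx : x ∉ A) (hy : y ∉ A) (hxy : x ≠ y) :
    ∃ e : V ≃ Fin (Fintype.card V), (∀ a ∈ A, (e a).val < A.card) ∧ (e x).val = A.card ∧
      (e y).val = A.card + 1 := by
  set l := A.toList ++ x :: y :: (Finset.univ \ (insert x (insert y A))).toList with hl
  have hxA : x ∉ A.toList := by rwa [Finset.mem_toList]
  have hyA : y ∉ A.toList := by rwa [Finset.mem_toList]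
  have hnd : l.Nodup := by
    rw [hl, List.nodup_append']
    refine ⟨Finset.nodup_toList _, ?_, ?_⟩
    · simp [hxy, Finset.nodup_toList]
    · intro v hv hv'
      rw [Finset.mem_toList] at hv
      simp at hv'
      rcases hv' with rfl | rfl | h
      · exact hx hv
      · exact hy hv
      · exact h.2.2 hv
  have hmem : ∀ v, v ∈ l := by
    intro v
    simp only [hl, List.mem_append, Finset.mem_toList, List.mem_cons, Finset.mem_sdiff,
      Finset.mem_univ, true_and, Finset.mem_insert]
    tauto
  have hlen : l.length = Fintype.card V := by
    rw [← List.toFinset_card_of_nodup hnd, ← Finset.card_univ]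
    congr 1
    ext v
    simp [hmem v]
  refine ⟨(List.Nodup.getEquivOfForallMemList l hnd hmem).symm.trans (finCongr hlen), ?_, ?_, ?_⟩
  · intro a ha
    have ha' : a ∈ A.toList := by rwa [Finset.mem_toList]
    change l.idxOf a < _
    rw [hl, List.idxOf_append_of_mem ha', ← Finset.length_toList]
    exact List.idxOf_lt_length_of_mem ha'
  · change l.idxOf x = _
    rw [hl, List.idxOf_append_of_notMem hxA]
    simp
  · change l.idxOf y = _
    rw [hl, List.idxOf_append_of_notMem hyA]
    rw [List.idxOf_cons_ne _ hxy]
    simp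

/-- The first `t` vertices. -/
def firstVertices (n t : ℕ) : Finset (Fin n) := Finset.univ.filter fun i => i.val < t

theorem mem_firstVertices {i : Fin n} : i ∈ firstVertices n t ↔ i.val < t := by
  simp [firstVertices]

theorem card_firstVertices (h : t ≤ n) : (firstVertices n t).card = t := by
  unfold firstVertices
  rw [Fin.card_filter_val_lt]
  omega

/-- Two hubs and two other vertices can be placed with the hubs in positions 2, 3 or 2, 4 or 1, 3.
This is the source of the factor 3. -/
theorem le_card_fourPaths_hubGraph {V : Type*} [DecidableEq V] [Fintype V] (A : Finset V) :
    3 * (A.card * (A.card - 1) * (Aᶜ.card * (Aᶜ.card - 1))) ≤ (fourPaths (hubGraph A)).card := by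
  classical
  let P := A.offDiag ×ˢ Aᶜ.offDiag
  have hP : P.card = A.card * (A.card - 1) * (Aᶜ.card * (Aᶜ.card - 1)) := by
    simp only [P, Finset.card_product, Finset.offDiag_card, Nat.mul_sub, mul_one]
  let code : V → Bool := fun v => decide (v ∈ A)
  let code4 : V × V × V × V → Bool × Bool × Bool × Bool :=
    fun p => (code p.1, code p.2.1, code p.2.2.1, code p.2.2.2)
  set T := fourPaths (hubGraph A) with hT
  let C : Finset (Bool × Bool × Bool × Bool) :=
    {(false, true, true, false), (false, true, false, true), (true, false, true, false)}
  have hC : C.card = 3 := by decide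
  have key : ∀ (c : Bool × Bool × Bool × Bool) (f : (V × V) × V × V → V × V × V × V),
      Function.Injective f → (∀ a a' y b, a ∈ A → a' ∈ A → a ≠ a' → y ∉ A → b ∉ A → y ≠ b →
        f ((a, a'), y, b) ∈ T ∧ code4 (f ((a, a'), y, b)) = c) →
      P.card ≤ (T.filter fun p => code4 p = c).card := by
    intro c f hf h
    refine Finset.card_le_card_of_injOn f ?_ hf.injOn
    rintro ⟨⟨a, a'⟩, y, b⟩ hp
    simp only [P, Finset.coe_product, Set.mem_prod, Finset.mem_coe, Finset.mem_offDiag,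
      Finset.mem_compl] at hp
    rw [Finset.mem_coe, Finset.mem_filter]
    exact h a a' y b hp.1.1 hp.1.2.1 hp.1.2.2 hp.2.1 hp.2.2.1 hp.2.2.2
  have hne : ∀ a y, a ∈ A → y ∉ A → a ≠ y ∧ y ≠ a := by
    intro a y ha hy
    have : a ≠ y := fun e => hy (e ▸ ha)
    exact ⟨this, this.symm⟩
  have hmain : ∀ c ∈ C, P.card ≤ (T.filter fun p => code4 p = c).card := by
    intro c hc
    simp only [C, Finset.mem_insert, Finset.mem_singleton] at hc
    rcases hc with rfl | rfl | rfl
    · refine key _ (fun p => (p.2.1, p.1.1, p.1.2, p.2.2)) ?_ ?_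
      · rintro ⟨⟨a, a'⟩, y, b⟩ ⟨⟨c, c'⟩, z, d⟩ h
        simp only [Prod.mk.injEq] at h ⊢
        tauto
      · intro a a' y b ha ha' haa hy hb hyb
        exact ⟨by simp [hT, mem_fourPaths, hubGraph_adj, ha, ha', haa, hyb, hne a y ha hy,
          hne a' y ha' hy, hne a b ha hb, hne a' b ha' hb], by simp [code4, code, ha, ha', hy, hb]⟩
    · refine key _ (fun p => (p.2.1, p.1.1, p.2.2, p.1.2)) ?_ ?_
      · rintro ⟨⟨a, a'⟩, y, b⟩ ⟨⟨c, c'⟩, z, d⟩ h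
        simp only [Prod.mk.injEq] at h ⊢
        tauto
      · intro a a' y b ha ha' haa hy hb hyb
        exact ⟨by simp [hT, mem_fourPaths, hubGraph_adj, ha, ha', haa, hyb, hne a y ha hy,
          hne a' y ha' hy, hne a b ha hb, hne a' b ha' hb], by simp [code4, code, ha, ha', hy, hb]⟩
    · refine key _ (fun p => (p.1.1, p.2.1, p.1.2, p.2.2)) ?_ ?_
      · rintro ⟨⟨a, a'⟩, y, b⟩ ⟨⟨c, c'⟩, z, d⟩ h
        simp only [Prod.mk.injEq] at h ⊢
        tauto
      · intro a a' y b ha ha' haa hy hb hyb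
        exact ⟨by simp [hT, mem_fourPaths, hubGraph_adj, ha, ha', haa, hyb, hne a y ha hy,
          hne a' y ha' hy, hne a b ha hb, hne a' b ha' hb], by simp [code4, code, ha, ha', hy, hb]⟩
  calc 3 * (A.card * (A.card - 1) * (Aᶜ.card * (Aᶜ.card - 1))) = C.card • P.card := by
        rw [hC, hP, smul_eq_mul]
    _ ≤ ∑ c ∈ C, (T.filter fun p => code4 p = c).card := Finset.card_nsmul_le_sum _ _ _ hmain
    _ ≤ ∑ c, (T.filter fun p => code4 p = c).card :=
        Finset.sum_le_sum_of_subset (Finset.subset_univ _)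
    _ = T.card := (Finset.card_eq_sum_card_fiberwise fun _ _ => Finset.mem_univ _).symm

theorem extGraph_path_cases {x u v y m : ℕ} (htm : t ≤ m) (h1 : x < m ∧ u < m ∨ x < t ∨ u < t)
    (h2 : u < m ∧ v < m ∨ u < t ∨ v < t) (h3 : v < m ∧ y < m ∨ v < t ∨ y < t) :
    u < t ∧ v < t ∨ x < t ∧ v < t ∨ u < t ∧ y < t ∨ (u < m ∧ v < m ∧ y < m) ∨
      (x < m ∧ v < m ∧ y < m) ∨ (x < m ∧ u < m ∧ y < m) ∨ x < m ∧ u < m ∧ v < m := by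
  have e : ∀ z, z < t → z < m := fun z hz => by omega
  have ex := e x
  have eu := e u
  have ev := e v
  have ey := e y
  generalize (x < m) = X at *
  generalize (u < m) = U at *
  generalize (v < m) = V at *
  generalize (y < m) = Y at *
  generalize (x < t) = X' at *
  generalize (u < t) = U' at *
  generalize (v < t) = V' at *
  generalize (y < t) = Y' at *
  by_cases X <;> by_cases U <;> by_cases V <;> by_cases Y <;> simp_all

/-- A path either has two hubs in one of the three position pairs, leaving two free vertices, or has
three vertices in the clique of size `k - t`, leaving one (`extGraph_path_cases`). -/
theorem card_fourPaths_extGraph_le (htn : t ≤ n) (htk : t ≤ k - t) (hkn : k ≤ n) :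
    (fourPaths (extGraph n k t)).card ≤
      3 * (t * (t - 1) * n ^ 2) + 4 * ((k - t) ^ 3 * n) := by
  classical
  set A := firstVertices n t
  set K := firstVertices n (k - t)
  have hA : A.card = t := card_firstVertices htn
  have hK : K.card = k - t := card_firstVertices (by omega)
  let U : Finset (Fin n) := Finset.univ
  have hU : U.card = n := by simp [U]
  let O : Finset (Fin n × Fin n) := A.offDiag
  have hO : O.card = t * (t - 1) := by
    simp only [O, Finset.offDiag_card, hA, Nat.mul_sub, mul_one]
  set T := fourPaths (extGraph n k t) with hT
  let T1 := T.filter fun p => (p.2.1, p.2.2.1) ∈ O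
  let T2 := T.filter fun p => (p.1, p.2.2.1) ∈ O
  let T3 := T.filter fun p => (p.2.1, p.2.2.2) ∈ O
  let S1 := T.filter fun p => p.2.1 ∈ K ∧ p.2.2.1 ∈ K ∧ p.2.2.2 ∈ K
  let S2 := T.filter fun p => p.1 ∈ K ∧ p.2.2.1 ∈ K ∧ p.2.2.2 ∈ K
  let S3 := T.filter fun p => p.1 ∈ K ∧ p.2.1 ∈ K ∧ p.2.2.2 ∈ K
  let S4 := T.filter fun p => p.1 ∈ K ∧ p.2.1 ∈ K ∧ p.2.2.1 ∈ K
  have hcov : T ⊆ T1 ∪ (T2 ∪ (T3 ∪ (S1 ∪ (S2 ∪ (S3 ∪ S4))))) := by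
    rintro ⟨x, u, v, y⟩ hp
    have hp' := mem_fourPaths.1 hp
    simp only [T1, T2, T3, S1, S2, S3, S4, O, A, K, Finset.mem_union, Finset.mem_filter, hp,
      true_and, Finset.mem_offDiag, mem_firstVertices]
    simp only [extGraph_adj] at hp'
    obtain ⟨⟨-, h1⟩, ⟨h2', h2⟩, ⟨-, h3⟩, h4, -, h6⟩ := hp'
    simp only [ne_eq, h2', h4, h6, not_false_eq_true, and_true]
    exact extGraph_path_cases htk h1 h2 h3
  have b2 : ∀ (S : Finset (Fin n × Fin n × Fin n × Fin n))
      (f g : Fin n × Fin n × Fin n × Fin n → Fin n × Fin n),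
      (∀ p q, f p = f q → g p = g q → p = q) → (∀ p ∈ S, f p ∈ O) →
      S.card ≤ t * (t - 1) * n ^ 2 := by
    intro S f g hinj hS
    have := card_le_sum_card (S := S) f g O (fun _ => U ×ˢ U) (fun p _ q _ => hinj p q)
      (fun p hp => ⟨hS p hp, by simp [U]⟩)
    rwa [Finset.sum_const, Finset.card_product, hO, hU, smul_eq_mul, ← sq] at this
  have b3 : ∀ (S : Finset (Fin n × Fin n × Fin n × Fin n))
      (f : Fin n × Fin n × Fin n × Fin n → Fin n × Fin n × Fin n)
      (g : Fin n × Fin n × Fin n × Fin n → Fin n),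
      (∀ p q, f p = f q → g p = g q → p = q) → (∀ p ∈ S, f p ∈ K ×ˢ K ×ˢ K) →
      S.card ≤ (k - t) ^ 3 * n := by
    intro S f g hinj hS
    have := card_le_sum_card (S := S) f g (K ×ˢ K ×ˢ K) (fun _ => U) (fun p _ q _ => hinj p q)
      (fun p hp => ⟨hS p hp, by simp [U]⟩)
    rw [Finset.sum_const, Finset.card_product, Finset.card_product, hK, hU, smul_eq_mul] at this
    refine this.trans (le_of_eq ?_)
    ring
  have c1 : T1.card ≤ _ := b2 T1 (fun p => (p.2.1, p.2.2.1)) (fun p => (p.1, p.2.2.2))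
    (fun p q h h' => quad_ext (Prod.mk.inj h').1 (Prod.mk.inj h).1 (Prod.mk.inj h).2
      (Prod.mk.inj h').2) (fun p hp => (Finset.mem_filter.1 hp).2)
  have c2 : T2.card ≤ _ := b2 T2 (fun p => (p.1, p.2.2.1)) (fun p => (p.2.1, p.2.2.2))
    (fun p q h h' => quad_ext (Prod.mk.inj h).1 (Prod.mk.inj h').1 (Prod.mk.inj h).2
      (Prod.mk.inj h').2) (fun p hp => (Finset.mem_filter.1 hp).2)
  have c3 : T3.card ≤ _ := b2 T3 (fun p => (p.2.1, p.2.2.2)) (fun p => (p.1, p.2.2.1))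
    (fun p q h h' => quad_ext (Prod.mk.inj h').1 (Prod.mk.inj h).1 (Prod.mk.inj h').2
      (Prod.mk.inj h).2) (fun p hp => (Finset.mem_filter.1 hp).2)
  have d1 : S1.card ≤ _ := b3 S1 (fun p => (p.2.1, p.2.2.1, p.2.2.2)) (fun p => p.1)
    (fun p q h h' => quad_ext h' (Prod.mk.inj h).1 (Prod.mk.inj (Prod.mk.inj h).2).1
      (Prod.mk.inj (Prod.mk.inj h).2).2)
    (fun p hp => by simpa using (Finset.mem_filter.1 hp).2)
  have d2 : S2.card ≤ _ := b3 S2 (fun p => (p.1, p.2.2.1, p.2.2.2)) (fun p => p.2.1)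
    (fun p q h h' => quad_ext (Prod.mk.inj h).1 h' (Prod.mk.inj (Prod.mk.inj h).2).1
      (Prod.mk.inj (Prod.mk.inj h).2).2)
    (fun p hp => by simpa using (Finset.mem_filter.1 hp).2)
  have d3 : S3.card ≤ _ := b3 S3 (fun p => (p.1, p.2.1, p.2.2.2)) (fun p => p.2.2.1)
    (fun p q h h' => quad_ext (Prod.mk.inj h).1 (Prod.mk.inj (Prod.mk.inj h).2).1 h'
      (Prod.mk.inj (Prod.mk.inj h).2).2)
    (fun p hp => by simpa using (Finset.mem_filter.1 hp).2)
  have d4 : S4.card ≤ _ := b3 S4 (fun p => (p.1, p.2.1, p.2.2.1)) (fun p => p.2.2.2)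
    (fun p q h h' => quad_ext (Prod.mk.inj h).1 (Prod.mk.inj (Prod.mk.inj h).2).1
      (Prod.mk.inj (Prod.mk.inj h).2).2 h')
    (fun p hp => by simpa using (Finset.mem_filter.1 hp).2)
  have hu := (Finset.card_le_card hcov).trans (Finset.card_union_le _ _)
  have hu2 := Finset.card_union_le T2 (T3 ∪ (S1 ∪ (S2 ∪ (S3 ∪ S4))))
  have hu3 := Finset.card_union_le T3 (S1 ∪ (S2 ∪ (S3 ∪ S4)))
  have hu4 := Finset.card_union_le S1 (S2 ∪ (S3 ∪ S4))
  have hu5 := Finset.card_union_le S2 (S3 ∪ S4)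
  have hu6 := Finset.card_union_le S3 S4
  omega

/-- Every edge of the extremal graph lies in a path with four vertices. -/
theorem extGraph_exists_fourPath (ht : 2 ≤ t) (htk : t ≤ k - t) (hkn : k + 2 ≤ n) (i j : Fin n)
    (h : (extGraph n k t).Adj i j) : ∃ a b, (j, i, a, b) ∈ fourPaths (extGraph n k t) ∨
      (i, j, a, b) ∈ fourPaths (extGraph n k t) ∨ (a, j, i, b) ∈ fourPaths (extGraph n k t) := by
  have hi := i.isLt
  have hj := j.isLt
  rw [extGraph_adj] at h
  have hne : i.val ≠ j.val := fun e => h.1 (Fin.ext e)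
  have mk : ∀ x u v y : Fin n, x.val ≠ u.val → x.val ≠ v.val → x.val ≠ y.val → u.val ≠ v.val →
      u.val ≠ y.val → v.val ≠ y.val → (x.val < k - t ∧ u.val < k - t ∨ x.val < t ∨ u.val < t) →
      (u.val < k - t ∧ v.val < k - t ∨ u.val < t ∨ v.val < t) →
      (v.val < k - t ∧ y.val < k - t ∨ v.val < t ∨ y.val < t) →
      (x, u, v, y) ∈ fourPaths (extGraph n k t) := by
    intro x u v y h1 h2 h3 h4 h5 h6 h7 h8 h9
    rw [mem_fourPaths, extGraph_adj, extGraph_adj, extGraph_adj, Ne, Ne, Ne, Ne, Ne, Ne,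
      Fin.ext_iff, Fin.ext_iff, Fin.ext_iff, Fin.ext_iff, Fin.ext_iff, Fin.ext_iff]
    exact ⟨⟨h1, h7⟩, ⟨h4, h8⟩, ⟨h6, h9⟩, h2, h3, h5⟩
  have hb : ∀ c : ℕ, ∃ b : Fin n, k ≤ b.val ∧ b.val ≠ c := by
    intro c
    by_cases hc : c = n - 1
    · exact ⟨⟨n - 2, by omega⟩, by simp only; omega, by simp only; omega⟩
    · exact ⟨⟨n - 1, by omega⟩, by simp only; omega, by simp only; omega⟩
  have ha : ∀ c : ℕ, ∃ a : Fin n, a.val < t ∧ a.val ≠ c := by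
    intro c
    by_cases hc : c = 0
    · exact ⟨⟨1, by omega⟩, by simp only; omega, by simp only; omega⟩
    · exact ⟨⟨0, by omega⟩, by simp only; omega, by simp only; omega⟩
  by_cases hit : i.val < t <;> by_cases hjt : j.val < t
  · obtain ⟨b, hb1, -⟩ := hb 0
    obtain ⟨b', hb1', hb2'⟩ := hb b.val
    exact ⟨b, b', Or.inr (Or.inr (by apply mk <;> omega))⟩
  · obtain ⟨b, hb1, hb2⟩ := hb j.val
    obtain ⟨a, ha1, ha2⟩ := ha i.val
    exact ⟨b, a, Or.inl (by apply mk <;> omega)⟩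
  · obtain ⟨b, hb1, hb2⟩ := hb i.val
    obtain ⟨a, ha1, ha2⟩ := ha j.val
    exact ⟨b, a, Or.inr (Or.inl (by apply mk <;> omega))⟩
  · obtain ⟨b, hb1, hb2⟩ := hb 0
    obtain ⟨a, ha1, ha2⟩ := ha i.val
    exact ⟨a, b, Or.inl (by apply mk <;> omega)⟩

end ExtremalGraph

/-! ### Uniqueness and asymptotics -/

section Extremal

theorem exists_equiv_fin_self {n : ℕ} {A : Finset (Fin n)} {x y : Fin n}
    (hx : x ∉ A) (hy : y ∉ A) (hxy : x ≠ y) :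
    ∃ e : Fin n ≃ Fin n, (∀ a ∈ A, (e a).val < A.card) ∧ (e x).val = A.card ∧
      (e y).val = A.card + 1 := by
  obtain ⟨e, h1, h2, h3⟩ := exists_equiv_fin hx hy hxy
  exact ⟨e.trans (finCongr (Fintype.card_fin n)), h1, h2, h3⟩

theorem exists_pair_notMem {n : ℕ} {A : Finset (Fin n)} (h : A.card + 2 ≤ n) :
    ∃ x y, x ∉ A ∧ y ∉ A ∧ x ≠ y := by
  have hc : 1 < Aᶜ.card := by
    rw [Finset.card_compl, Fintype.card_fin]
    omega
  obtain ⟨x, hx, y, hy, hxy⟩ := Finset.one_lt_card.1 hc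
  exact ⟨x, y, Finset.mem_compl.1 hx, Finset.mem_compl.1 hy, hxy⟩

theorem card_fourPaths_hubGraph_le_extGraph {n k t : ℕ} {A : Finset (Fin n)} (hA : A.card = t)
    (hn : t + 2 ≤ n) : (fourPaths (hubGraph A)).card ≤ (fourPaths (extGraph n k t)).card := by
  obtain ⟨x, y, hx, hy, hxy⟩ := exists_pair_notMem (A := A) (by omega)
  obtain ⟨e, he, -⟩ := exists_equiv_fin_self hx hy hxy
  refine card_fourPaths_le_of_hom e e.injective ?_
  rintro u v ⟨huv, h⟩
  refine ⟨e.injective.ne huv, Or.inr ?_⟩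
  rw [← hA]
  exact h.imp (he u) (he v)

/-- The hub graph on `t` vertices embeds, and `(n - t)(n - t - 1)` falls short of `n ^ 2` by at most
`(2 * t + 1) * n`. -/
theorem le_card_fourPaths_extGraph {n k t : ℕ} (hn : t + 2 ≤ n) :
    3 * t * (t - 1) * n ^ 2 ≤
      (fourPaths (extGraph n k t)).card + 3 * t * (t - 1) * (2 * t + 1) * n := by
  have h1 := le_card_fourPaths_hubGraph (firstVertices n t)
  have h2 := card_fourPaths_hubGraph_le_extGraph (k := k)
    (card_firstVertices (n := n) (t := t) (by omega)) hn
  rw [Finset.card_compl, card_firstVertices (by omega), Fintype.card_fin] at h1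
  obtain ⟨d, rfl⟩ := Nat.exists_eq_add_of_le hn
  rw [show t + 2 + d - t = d + 2 by omega, show d + 2 - 1 = d + 1 by omega] at h1
  have h3 : (t + 2 + d) ^ 2 ≤ (d + 2) * (d + 1) + (2 * t + 1) * (t + 2 + d) := by nlinarith
  calc 3 * t * (t - 1) * (t + 2 + d) ^ 2 ≤
        3 * t * (t - 1) * ((d + 2) * (d + 1) + (2 * t + 1) * (t + 2 + d)) :=
        Nat.mul_le_mul le_rfl h3
    _ = 3 * (t * (t - 1) * ((d + 2) * (d + 1))) + 3 * t * (t - 1) * (2 * t + 1) * (t + 2 + d) := by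
        ring
    _ ≤ _ := Nat.add_le_add_right (h1.trans h2) _

/-- A graph whose edges outside a set of `t` vertices form at most one edge (none, if `k` is odd)
embeds into the extremal graph. -/
theorem nonempty_iso_extGraph {n k t : ℕ} {G : SimpleGraph (Fin n)} [DecidableRel G.Adj]
    (ht : 2 ≤ t) (htk : 2 * t ≤ k) (hkn : k + 2 ≤ n) {A : Finset (Fin n)} (hA : A.card = t)
    {x y : Fin n} (hx : x ∉ A) (hy : y ∉ A) (hxy : x ≠ y)
    (hG : ∀ u v, G.Adj u v → u ∈ A ∨ v ∈ A ∨
      (k = 2 * t + 2 ∧ (u = x ∨ u = y) ∧ (v = x ∨ v = y)))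
    (hT : (fourPaths (extGraph n k t)).card ≤ (fourPaths G).card) :
    Nonempty (G ≃g extGraph n k t) := by
  classical
  obtain ⟨e, he, hex, hey⟩ := exists_equiv_fin_self hx hy hxy
  rw [hA] at he hex hey
  set G' := G.comap e.symm with hG'
  have hle : G' ≤ extGraph n k t := by
    intro u v huv
    have huv' : G.Adj (e.symm u) (e.symm v) := huv
    refine ⟨huv.ne, ?_⟩
    have key : ∀ w, (e.symm w = x ∨ e.symm w = y) → w.val < t + 2 := by
      rintro w (h | h)
      · rw [Equiv.symm_apply_eq] at h
        rw [h, hex]; omega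
      · rw [Equiv.symm_apply_eq] at h
        rw [h, hey]; omega
    rcases hG _ _ huv' with h | h | ⟨h, h1, h2⟩
    · right; left
      simpa using he _ h
    · right; right
      simpa using he _ h
    · left
      have := key u h1
      have := key v h2
      omega
  have hcard : (fourPaths G).card ≤ (fourPaths G').card :=
    card_fourPaths_le_of_hom e e.injective fun u v huv => by simpa [hG'] using huv
  have heq := eq_of_le_of_card_fourPaths_le hle (hT.trans hcard)
    (extGraph_exists_fourPath ht (by omega) hkn)
  refine ⟨⟨e, ?_⟩⟩
  intro u v
  rw [← heq]
  simp [hG']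

/-- Graphs without a path of length `k` that have at least as many paths with four vertices as
the extremal graph are isomorphic to it. -/
theorem exists_forall_nonempty_iso {k t : ℕ} (ht : 2 ≤ t) (hk : k = 2 * t + 1 ∨ k = 2 * t + 2) :
    ∃ n₁ : ℕ, ∀ n, n₁ ≤ n → ∀ (G : SimpleGraph (Fin n)) [DecidableRel G.Adj],
      NoPath G (k + 1) → (fourPaths (extGraph n k t)).card ≤ (fourPaths G).card →
      Nonempty (G ≃g extGraph n k t) := by
  set K := 2 * t + 2 with hK
  set s := stabilityConst t with hs
  set c := 2 * K * (t + 1) with hc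
  set q := 3 * t * (t - 1) + c ^ 2 with hq
  -- If `d` is the number of vertices beyond `B.card - 2`, this choice gives `2 * (q * d) ≤ n + 4 *
  -- q`. Since `q` bounds the total loss per such vertex, the loss stays below the gain `n` in
  -- `card_fourPaths_lt_hubGraph`.
  set M := 2 * q * s + s + 1 with hM
  obtain ⟨n₀, hn₀⟩ := exists_hub_set (t := t) (M := M) ht (by omega)
  refine ⟨n₀ + M * (3 * t * (t - 1) * (2 * t + 1)) + M * (2 * t + 5) +
    (4 * q + 2 * (c * t ^ 2) + 1) + k + 2, ?_⟩
  intro n hn G _ hP hT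
  have hP' : NoPath G (2 * t + 3) := fun l hl => (hP l hl).trans_le (by omega)
  have hlow := le_card_fourPaths_extGraph (n := n) (k := k) (t := t) (by omega)
  obtain ⟨A, hA, hfull⟩ := hn₀ (Fin n) G (by rw [Fintype.card_fin]; omega) hP' (by
    rw [Fintype.card_fin]
    calc M * (3 * t * (t - 1) * n ^ 2) ≤
          M * ((fourPaths G).card + 3 * t * (t - 1) * (2 * t + 1) * n) :=
          Nat.mul_le_mul le_rfl (hlow.trans (Nat.add_le_add_right hT _))
      _ = M * (fourPaths G).card + (M * (3 * t * (t - 1) * (2 * t + 1))) * n := by ring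
      _ ≤ M * (fourPaths G).card + n * n :=
          Nat.add_le_add_left (Nat.mul_le_mul (by omega) le_rfl) _
      _ = _ := by ring)
  rw [Fintype.card_fin] at hfull
  set B := Finset.univ.filter fun x => ∀ a ∈ A, G.Adj x a with hBdef
  replace hfull : M * n ≤ M * B.card + s * n := by convert hfull
  have hB : ∀ c ∈ A, ∀ b ∈ B, G.Adj b c := fun c hc b hb => (Finset.mem_filter.1 hb).2 c hc
  have hBn : B.card ≤ n := (Finset.card_le_univ B).trans_eq (Fintype.card_fin n)
  have hBcard : 2 * t + 4 < B.card := by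
    by_contra! hlt
    have h1 : M * B.card ≤ M * (2 * t + 4) := Nat.mul_le_mul le_rfl hlt
    have h2 : (s + 1) * n ≤ M * n :=
      Nat.mul_le_mul (by have := Nat.zero_le (2 * q * s); omega) le_rfl
    have h3 : M * (2 * t + 5) = M * (2 * t + 4) + M := by ring
    have h4 : (s + 1) * n = s * n + n := by ring
    have : M * (2 * t + 5) ≤ n := by omega
    omega
  have hBA : B ⊆ Aᶜ := by
    intro b hb
    rw [Finset.mem_compl]
    exact fun hbA => G.loopless.irrefl b (hB b hbA b hb)
  have hO := outerEdges_of_noPath hA ht hP' hB hBcard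
  set Y := nonIsolated G Aᶜ with hY
  have hYA : Y ⊆ Aᶜ := Finset.filter_subset _ _
  -- The outer graph is too large: any edge for odd `k`, more than a single edge for even `k`.
  by_cases hbad : 0 < Y.card ∧ (k = 2 * t + 1 ∨ 3 ≤ Y.card)
  · exfalso
    have hsum : ∑ q ∈ Y, dg G A q * (3 * (t - 1) + dg G Aᶜ q) + Y.card ≤
        3 * t * (t - 1) * Y.card := by
      rcases hbad.2 with hk1 | h3
      -- For `k = 2 * t + 1` an attached outer edge already yields a path on `2 * t + 2` vertices,
      -- so no vertex of `Y` has a neighbour in `A`.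
      · rw [Finset.sum_eq_zero, zero_add]
        · refine Nat.le_mul_of_pos_left _ ?_
          exact Nat.mul_pos (by omega) (by omega)
        · intro x hx
          obtain ⟨hxA, y, hyA, hxy⟩ := exists_adj_of_mem_nonIsolated hx
          rw [Finset.mem_compl] at hxA hyA
          rw [Nat.mul_eq_zero]
          left
          by_contra hne
          obtain ⟨a, ha⟩ := Finset.card_pos.1 (Nat.pos_of_ne_zero hne)
          rw [Finset.mem_filter] at ha
          have := length_add_lt hP hB (l := [y]) ⟨by simpa using hxy, by simp [hxy.ne]⟩ ha.1
            (by omega) ha.2 (by intro v hv; simp at hv; rcases hv with rfl | rfl <;> assumption)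
            (by simp; omega)
          simp at this
          omega
      · exact hO.sum_charge_le hA ht h3
    have hBY : (B ∩ Y).card ≤ 2 := hO.card_inter_nonIsolated_le (by omega) hB
    have hb : B.card - 2 ≤ (Aᶜ \ Y).card := by
      have h1 := Finset.card_le_card (Finset.sdiff_subset_sdiff hBA (le_refl Y))
      have h2 := Finset.card_sdiff_add_card_inter B Y
      omega
    have hm : Y.card + (Aᶜ \ Y).card ≤ n := by
      rw [← Finset.card_union_of_disjoint Finset.disjoint_sdiff]
      exact (Finset.card_le_univ _).trans_eq (Fintype.card_fin n)
    obtain ⟨d, hd⟩ := Nat.exists_eq_add_of_le (show B.card - 2 ≤ n by omega)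
    have hqd : 2 * (q * d) ≤ n + 4 * q := by
      have h1 : M * d ≤ s * n + 2 * M := by
        have e1 : M * n = M * (B.card - 2) + M * d := by rw [← Nat.mul_add, ← hd]
        have e2 : M * B.card = M * (B.card - 2) + 2 * M := by
          rw [mul_comm 2 M, ← Nat.mul_add]
          congr 1
          omega
        omega
      have h2 : M * (2 * (q * d)) ≤ M * (n + 4 * q) := by
        calc M * (2 * (q * d)) = 2 * q * (M * d) := by ring
          _ ≤ 2 * q * (s * n + 2 * M) := Nat.mul_le_mul le_rfl h1
          _ = (2 * q * s) * n + M * (4 * q) := by ring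
          _ ≤ M * n + M * (4 * q) :=
            Nat.add_le_add_right (Nat.mul_le_mul (by omega) le_rfl) _
          _ = _ := by ring
      exact Nat.le_of_mul_le_mul_left h2 (by omega)
    have hlt := card_fourPaths_lt_hubGraph (K := K) hA hP' hbad.1 hsum hb (by
      rw [Fintype.card_fin]
      have hYd : Y.card ≤ d := by omega
      have h1 : c ^ 2 * Y.card ≤ c ^ 2 * d := Nat.mul_le_mul le_rfl hYd
      have h2 : 3 * t * (t - 1) * n = 3 * t * (t - 1) * (B.card - 2) + 3 * t * (t - 1) * d := by
        rw [← Nat.mul_add, ← hd]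
      have h3 : q * d = 3 * t * (t - 1) * d + c ^ 2 * d := by rw [hq, Nat.add_mul]
      change 3 * t * (t - 1) * n + c * t ^ 2 + c ^ 2 * Y.card < _
      omega)
    have := card_fourPaths_hubGraph_le_extGraph (k := k) hA (by omega : t + 2 ≤ n)
    omega
  · have hedge : ∀ u v, G.Adj u v → u ∈ A ∨ v ∈ A ∨ (u ∈ Y ∧ v ∈ Y) := by
      intro u v huv
      by_cases hu : u ∈ A
      · exact Or.inl hu
      by_cases hv : v ∈ A
      · exact Or.inr (Or.inl hv)
      rw [← Finset.mem_compl] at hu hv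
      exact Or.inr (Or.inr ⟨mem_nonIsolated_of_adj hu hv huv,
        mem_nonIsolated_of_adj hv hu huv.symm⟩)
    rcases Y.eq_empty_or_nonempty with hY0 | ⟨x, hx⟩
    · obtain ⟨x, y, hx, hy, hxy⟩ := exists_pair_notMem (A := A) (by omega)
      refine nonempty_iso_extGraph ht (by omega) (by omega) hA hx hy hxy ?_ hT
      intro u v huv
      have := hedge u v huv
      simp only [hY0, Finset.notMem_empty, false_and, or_false] at this
      tauto
    · have hpos : 0 < Y.card := Finset.card_pos.2 ⟨x, hx⟩
      obtain ⟨hxA, y, hyA, hxy⟩ := exists_adj_of_mem_nonIsolated hx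
      have hyY := mem_nonIsolated_of_adj hyA hxA hxy.symm
      have hYeq : ({x, y} : Finset (Fin n)) = Y := by
        apply Finset.eq_of_subset_of_card_le
        · intro z hz
          rw [Finset.mem_insert, Finset.mem_singleton] at hz
          rcases hz with rfl | rfl <;> assumption
        · rw [Finset.card_pair hxy.ne]
          by_contra! hlt
          exact hbad ⟨hpos, Or.inr hlt⟩
      refine nonempty_iso_extGraph ht (by omega) (by omega) hA (Finset.mem_compl.1 hxA)
        (Finset.mem_compl.1 hyA) hxy.ne ?_ hT
      intro u v huv
      have h1 := hedge u v huv
      rw [← hYeq] at h1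
      simp only [Finset.mem_insert, Finset.mem_singleton] at h1
      rcases h1 with h1 | h1 | h1
      · exact Or.inl h1
      · exact Or.inr (Or.inl h1)
      · refine Or.inr (Or.inr ⟨?_, h1⟩)
        by_contra hne
        exact hbad ⟨hpos, Or.inl (by omega)⟩

theorem copyCount_congr {n : ℕ} {G H : SimpleGraph (Fin n)} (e : G ≃g H) :
    G.copyCount (pathOfLength 3) = H.copyCount (pathOfLength 3) := by
  classical
  have h1 := two_mul_copyCount (G := G)
  have h2 := two_mul_copyCount (G := H)
  have h3 : (fourPaths G).card ≤ (fourPaths H).card :=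
    card_fourPaths_le_of_hom e e.injective fun x y h => e.map_adj_iff.2 h
  have h4 : (fourPaths H).card ≤ (fourPaths G).card :=
    card_fourPaths_le_of_hom e.symm e.symm.injective fun x y h => e.symm.map_adj_iff.2 h
  omega

/-- The number of copies and the uniqueness of the extremal graph. -/
theorem ex_eq_and_isExtremalFor_iff {k t : ℕ} (ht : 2 ≤ t)
    (hk : k = 2 * t + 1 ∨ k = 2 * t + 2) :
    ∃ n₁ : ℕ, ∀ n : ℕ, n₁ ≤ n →
      ex n (pathOfLength 3) (pathOfLength k) = (extGraph n k t).copyCount (pathOfLength 3) ∧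
      ∀ G : SimpleGraph (Fin n),
        IsExtremalFor G (pathOfLength 3) (pathOfLength k) ↔ Nonempty (G ≃g extGraph n k t) := by
  classical
  obtain ⟨n₁, hn₁⟩ := exists_forall_nonempty_iso ht hk
  refine ⟨n₁, fun n hn => ?_⟩
  have hext : (pathOfLength k).Free (extGraph n k t) :=
    free_pathOfLength_iff.2 (extGraph_noPath hk)
  have hiso : ∀ G : SimpleGraph (Fin n), (pathOfLength k).Free G →
      (extGraph n k t).copyCount (pathOfLength 3) ≤ G.copyCount (pathOfLength 3) →
      Nonempty (G ≃g extGraph n k t) := by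
    intro G hG hle
    refine hn₁ n hn G (free_pathOfLength_iff.1 hG) ?_
    rw [← two_mul_copyCount, ← two_mul_copyCount]
    omega
  have hex : ex n (pathOfLength 3) (pathOfLength k) =
      (extGraph n k t).copyCount (pathOfLength 3) := by
    unfold ex
    apply le_antisymm
    · apply Finset.sup_le
      intro G hG
      by_contra! hlt
      obtain ⟨e⟩ := hiso G (Finset.mem_filter.1 hG).2 hlt.le
      exact hlt.ne' (copyCount_congr e)
    · exact Finset.le_sup (f := fun G : SimpleGraph (Fin n) => G.copyCount (pathOfLength 3))
        (Finset.mem_filter.2 ⟨Finset.mem_univ _, hext⟩)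
  refine ⟨hex, fun G => ⟨fun h => hiso G h.1 ?_, ?_⟩⟩
  · rw [h.2, hex]
  · rintro ⟨e⟩
    exact ⟨(SimpleGraph.free_congr_right e).2 hext, by rw [hex, copyCount_congr e]⟩

/-- For large `n` the value is that of the extremal graph, whose path count is within `C * n` of
`3t(t-1)n²` on both sides; each copy counts twice. -/
theorem ex_sub_isBigO {k t : ℕ} (ht : 2 ≤ t) (hk : k = 2 * t + 1 ∨ k = 2 * t + 2) :
    (fun n : ℕ => (ex n (pathOfLength 3) (pathOfLength k) : ℝ) -
      3 * (t : ℝ) * ((t : ℝ) - 1) / 2 * (n : ℝ) ^ 2) =O[atTop] (fun n : ℕ => (n : ℝ)) := by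
  obtain ⟨n₁, hn₁⟩ := ex_eq_and_isExtremalFor_iff ht hk
  set C := 3 * t * (t - 1) * (2 * t + 1) + 4 * (k - t) ^ 3 with hC
  refine IsBigO.of_bound (C : ℝ) ?_
  filter_upwards [eventually_ge_atTop (n₁ + k + t + 2)] with n hn
  have h1 := le_card_fourPaths_extGraph (n := n) (k := k) (t := t) (by omega)
  have h2 := card_fourPaths_extGraph_le (n := n) (k := k) (t := t) (by omega) (by omega) (by omega)
  rw [← two_mul_copyCount, ← (hn₁ n (by omega)).1] at h1 h2
  generalize ex n (pathOfLength 3) (pathOfLength k) = E at h1 h2 ⊢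
  have h3 : C * n = 3 * t * (t - 1) * (2 * t + 1) * n + 4 * ((k - t) ^ 3 * n) := by
    rw [hC]; ring
  have h4 : 3 * t * (t - 1) * n ^ 2 ≤ 2 * E + C * n := by omega
  have h5 : 2 * E ≤ 3 * t * (t - 1) * n ^ 2 + C * n := by
    have : 3 * (t * (t - 1) * n ^ 2) = 3 * t * (t - 1) * n ^ 2 := by ring
    omega
  have hcast : ((t - 1 : ℕ) : ℝ) = (t : ℝ) - 1 := by
    rw [Nat.cast_sub (by omega), Nat.cast_one]
  have h4' : (3 * t * ((t - 1 : ℕ) : ℝ) * n ^ 2 : ℝ) ≤ 2 * E + C * n := by exact_mod_cast h4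
  have h5' : (2 * E : ℝ) ≤ 3 * t * ((t - 1 : ℕ) : ℝ) * n ^ 2 + C * n := by exact_mod_cast h5
  rw [hcast] at h4' h5'
  have hCn : (0 : ℝ) ≤ C * n := by positivity
  rw [Real.norm_eq_abs, Real.norm_eq_abs, abs_of_nonneg (Nat.cast_nonneg n : (0 : ℝ) ≤ n), abs_le]
  constructor <;> linarith

end Extremal

end GenTuran

theorem mainTheorem10 (k t : ℕ) (hk : 5 ≤ k) (ht : t = (k - 1) / 2) :
    (∃ n₁ : ℕ, ∀ n : ℕ, n₁ ≤ n →
      GenTuran.ex n (GenTuran.pathOfLength 3) (GenTuran.pathOfLength k) =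
        (GenTuran.extGraph n k t).copyCount (GenTuran.pathOfLength 3) ∧
      ∀ G : SimpleGraph (Fin n),
        GenTuran.IsExtremalFor G (GenTuran.pathOfLength 3) (GenTuran.pathOfLength k) ↔
          Nonempty (G ≃g GenTuran.extGraph n k t)) ∧
    (fun n : ℕ =>
        (GenTuran.ex n (GenTuran.pathOfLength 3) (GenTuran.pathOfLength k) : ℝ) -
          3 * (t : ℝ) * ((t : ℝ) - 1) / 2 * (n : ℝ) ^ 2)
      =O[atTop] (fun n : ℕ => (n : ℝ)) :=
  ⟨GenTuran.ex_eq_and_isExtremalFor_iff (by omega) (by omega),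
    GenTuran.ex_sub_isBigO (by omega) (by omega)⟩
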